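/- For a continuous function $W:\mathbb R\to\mathbb R$ put $A(x)=\int_0^x e^{W(y)}\,dy$. Call $W$ an environment if $A$ maps $\mathbb R$ onto $\mathbb R$, so that the inverse $A^{-1}:\mathbb R\to\mathbb R$ exists. Let $B=(B_s)_{s\ge 0}$ be a standard Brownian motion. The Brox diffusion in the environment $W$, started at $x\in\mathbb R$, is $$X^x_t=A^{-1}\bigl(A(x)+B_{T_x^{-1}(t)}\bigr),\qquad T_x(u)=\int_0^u e^{-2W(A^{-1}(A(x)+B_s))}\,ds,\qquad T_x^{-1}(t)=\inf\{u\ge 0: T_x(u)\ge t\}.$$ Let $C_0$ be the space of continuous functions $\mathbb R\to\mathbb R$ vanishing at $\pm\infty$, and for $f\in C_0$ put $H_tf(x)=\mathbb E[f(X^x_t)]$. The generator $L=L_W$, formally $\frac12 e^{W}\frac{d}{dx}\bigl(e^{-W}\frac{d}{dx}\bigr)$, is the infinitesimal generator of $(H_t)$: its domain $D=D_W$ is the set of all $f\in C_0$ for which there is a $g\in C_0$ with $\lim_{t\downarrow 0}\sup_{x\in\mathbb R}\bigl|\tfrac{H_tf(x)-f(x)}{t}-g(x)\bigr|=0$, and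 then $Lf=g$. **Proposition.** For every environment $W$, the domain $D_W$ is contained in $C^1(\mathbb R)$: every $f\in D_W$ is continuously differentiable on $\mathbb R$. In particular, if $W=(W(x))_{x\in\mathbb R}$ is a two-sided Brownian motion, then almost every trajectory of $W$ is an environment in the above sense and satisfies $D_W\subset C^1(\mathbb R)$. -/

import Mathlib

open MeasureTheory ProbabilityTheory Filter Topology
open scoped NNReal ZeroAtInfty

namespace Brox

/-- The scale function `A(x) = ∫₀ˣ e^{W(y)} dy` of the environment `W`. -/
noncomputable def scale (W : ℝ → ℝ) (x : ℝ) : ℝ :=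
  ∫ y in (0 : ℝ)..x, Real.exp (W y)

/-- An environment: a continuous trajectory `W : ℝ → ℝ` whose scale function maps `ℝ` onto `ℝ`,
so that `A⁻¹ : ℝ → ℝ` exists (see `scale_bijective`). -/
structure IsEnvironment (W : ℝ → ℝ) : Prop where
  continuous : Continuous W
  surjective_scale : Function.Surjective (scale W)

theorem scale_strictMono {W : ℝ → ℝ} (hW : Continuous W) : StrictMono (scale W) := by
  intro a b hab
  have hc : Continuous fun y => Real.exp (W y) := Real.continuous_exp.comp hW
  have h : 0 < ∫ y in a..b, Real.exp (W y) :=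
    intervalIntegral.intervalIntegral_pos_of_pos (hc.intervalIntegrable a b)
      (fun y => Real.exp_pos _) hab
  have h2 := intervalIntegral.integral_add_adjacent_intervals
    (hc.intervalIntegrable (μ := volume) 0 a) (hc.intervalIntegrable (μ := volume) a b)
  unfold scale
  linarith

theorem IsEnvironment.scale_bijective {W : ℝ → ℝ} (hW : IsEnvironment W) :
    Function.Bijective (scale W) :=
  ⟨(scale_strictMono hW.continuous).injective, hW.surjective_scale⟩

/-- The inverse `A⁻¹` of the scale function. -/
noncomputable def scaleInv (W : ℝ → ℝ) : ℝ → ℝ :=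
  Function.invFun (scale W)

/-- The clock `T(u) = ∫₀ᵘ e^{-2 W(A⁻¹(b(s)))} ds`, `u ≥ 0`, along the path `b`. -/
noncomputable def clock (W : ℝ → ℝ) (b : ℝ≥0 → ℝ) (u : ℝ) : ℝ :=
  ∫ s in (0 : ℝ)..u, Real.exp (-2 * W (scaleInv W (b s.toNNReal)))

/-- The inverse time change `T⁻¹(t) = inf {u ≥ 0 | T(u) ≥ t}`, `t ≥ 0`. -/
noncomputable def clockInv (W : ℝ → ℝ) (b : ℝ≥0 → ℝ) (t : ℝ) : ℝ :=
  sInf {u : ℝ | 0 ≤ u ∧ t ≤ clock W b u}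

/-- The time-changed path `X_t = A⁻¹(b(T⁻¹(t)))`. -/
noncomputable def timeChange (W : ℝ → ℝ) (b : ℝ≥0 → ℝ) (t : ℝ) : ℝ :=
  scaleInv W (b (clockInv W b t).toNNReal)

variable {Ω : Type*} [MeasurableSpace Ω]

/-- The Brox diffusion in the fixed environment `W`, started at `x` and driven by the standard
Brownian motion `B`: the time change of the Brownian motion `A(x) + B` started at `A(x)`. -/
noncomputable def process (B : ℝ≥0 → Ω → ℝ) (W : ℝ → ℝ) (x t : ℝ) (ω : Ω) : ℝ :=
  timeChange W (fun s => scale W x + B s ω) t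

/-- The quenched semigroup `H_t f(x) = E[f(X_t) | X_0 = x]`, for `f ∈ C₀(ℝ)`. -/
noncomputable def semigroup (B : ℝ≥0 → Ω → ℝ) (P : Measure Ω) (W : ℝ → ℝ) (t : ℝ)
    (f : C₀(ℝ, ℝ)) (x : ℝ) : ℝ :=
  ∫ ω, f (process B W x t ω) ∂P

/-- `g = L f`, where `L` is the infinitesimal generator of the semigroup on `C₀(ℝ)`:
`(H_t f - f) / t → g` in the supremum norm as `t ↓ 0`. -/
def IsGenerator (B : ℝ≥0 → Ω → ℝ) (P : Measure Ω) (W : ℝ → ℝ) (f g : C₀(ℝ, ℝ)) : Prop :=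
  TendstoUniformly (fun (t : ℝ) (x : ℝ) => (semigroup B P W t f x - f x) / t) g (𝓝[>] 0)

/-- The domain `D` of the generator `L`: all `f ∈ C₀(ℝ)` for which `L f ∈ C₀(ℝ)` exists. -/
def domain (B : ℝ≥0 → Ω → ℝ) (P : Measure Ω) (W : ℝ → ℝ) : Set C₀(ℝ, ℝ) :=
  {f | ∃ g : C₀(ℝ, ℝ), IsGenerator B P W f g}

/-- `W = (W(x))_{x ∈ ℝ}` is a two-sided Brownian motion: `(W(x))_{x ≥ 0}` and `(W(-x))_{x ≥ 0}`
are independent standard Brownian motions. -/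
structure IsTwoSidedBrownian (W : ℝ → Ω → ℝ) (μ : Measure Ω) : Prop where
  right : IsBrownianReal (fun (x : ℝ≥0) ω => W x ω) μ
  left : IsBrownianReal (fun (x : ℝ≥0) ω => W (-x) ω) μ
  indep : IndepFun (fun ω (x : ℝ≥0) => W x ω) (fun ω (x : ℝ≥0) => W (-x) ω) μ

end Brox

/-!
In the scale coordinate `z = A(x)` the Brox diffusion is the Brownian motion `y + B`, run with the
clock `∫ m(y + B_s) ds`, where the speed density `m = e^{-2 W ∘ A⁻¹}` is continuous and positive.
Its generator is formally `(1 / 2m) d²/dz²`, so that `F = f ∘ A⁻¹` should solve `F'' / 2 = m G` with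
`G = (L f) ∘ A⁻¹`, which is continuous. Since `f = F ∘ A` and `A` is continuously differentiable,
it suffices that `F` is.

The equation is obtained in the sense of touching parabolas, which needs neither the Markov
property of the diffusion nor a Dynkin formula. If `F` lies below the parabola
`F(y) + p (z - y) + κ (z - y)²` near `y`, then `m(y) G(y) ≤ κ` (`Brox.generator_le_of_touching`).
Indeed, for small `t` the inverse clock at `t` is, off an event of probability `O(t²)`, a stopping
time `θ ≤ C t` of `B` with `θ ≈ t / m(y)`; and for such times `E B_θ = 0`, `E B_θ² = E θ` and
`E B_θ⁴ = O(t²)` (`IsRegularBrownian.integral_stopped_le`). The moments come from grids: on a grid,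
`B_θ` is a sum of centred Gaussian increments, each multiplied by the indicator of an event that
belongs to the past (`moments_predictable_walk`). The same computation yields the maximal
inequality `IsRegularBrownian.measure_exists_lt_abs_le` that controls the exceptional event.
The reverse inequality for parabolas touching from below follows by passing to `-f`.

Subtracting from `F` a second primitive of `2 m G` leaves a function whose touching parabolas from
above all have a nonnegative leading coefficient, and likewise for its negative. Such a function is
convex and concave, hence affine, and `F` is smooth enough (`contDiff_one_of_touching`).

For a two-sided Brownian motion it remains to see that `∫₀^∞ e^{B_s} ds = ∞` almost surely
(`ae_expFunctional_eq_top`). Finiteness of this integral does not depend on the path up to a given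
time, so it has probability `0` or `1`; by symmetry the probability is the same for `-B`; and the
two integrals cannot both be finite because `e^b + e^{-b} ≥ 1`.
-/

/-! ### Functions with a second derivative in the sense of touching parabolas -/

/-- A function that is never touched from above by a strictly concave parabola is convex: if it
exceeded a chord, then a small concave parabola over the chord, raised until it touches the graph
from above, would do so at an interior point. -/
theorem convexOn_of_touching {h : ℝ → ℝ} (hc : Continuous h)
    (htouch : ∀ y p κ : ℝ, (∀ᶠ z in 𝓝 y, h z ≤ h y + p * (z - y) + κ * (z - y) ^ 2) → 0 ≤ κ) :
    ConvexOn ℝ Set.univ h := by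
  by_contra hcon
  have : ∃ a b x : ℝ, a < x ∧ x < b ∧ h a + (h b - h a) / (b - a) * (x - a) < h x := by
    by_contra! hle
    apply hcon
    refine convexOn_of_slope_mono_adjacent convex_univ ?_
    intro a x b _ _ hax hxb
    have h1 := hle a b x hax hxb
    have hba : 0 < b - a := by linarith
    have hxa : 0 < x - a := by linarith
    have hbx : 0 < b - x := by linarith
    have h2 : (h b - h a) * (x - a) ≥ (h x - h a) * (b - a) := by
      have : h x - h a ≤ (h b - h a) * (x - a) / (b - a) := by
        have e : (h b - h a) * (x - a) / (b - a) = (h b - h a) / (b - a) * (x - a) := by ring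
        linarith
      rw [le_div_iff₀ hba] at this
      exact this
    rw [div_le_div_iff₀ hxa hbx]
    nlinarith
  obtain ⟨a, b, x, hax, hxb, hx⟩ := this
  set s := (h b - h a) / (b - a) with hs
  have hba : 0 < b - a := by linarith
  have hsb : s * (b - a) = h b - h a := by rw [hs]; field_simp
  -- the excess over the chord at `x`, spread over the parabola vanishing at `a` and `b`
  set ε := (h x - (h a + s * (x - a))) / (2 * ((x - a) * (b - x))) with hε
  have hq : 0 < (x - a) * (b - x) := mul_pos (by linarith) (by linarith)
  have hεpos : 0 < ε := div_pos (by linarith) (by linarith)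
  have hεx : ε * ((x - a) * (b - x)) = (h x - (h a + s * (x - a))) / 2 := by
    rw [hε, div_mul_eq_mul_div, div_eq_div_iff (by positivity) two_ne_zero]; ring
  let k : ℝ → ℝ := fun z => h z - (h a + s * (z - a)) - ε * ((z - a) * (b - z))
  have hk : Continuous k := by fun_prop
  obtain ⟨y, hy, hmax⟩ := isCompact_Icc.exists_isMaxOn (Set.nonempty_Icc.2 (by linarith : a ≤ b))
    hk.continuousOn
  have hxk : 0 < k x := by simp only [k]; linarith
  have hyk : 0 < k y := hxk.trans_le (hmax ⟨hax.le, hxb.le⟩)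
  have hya : y ≠ a := by rintro rfl; simp [k] at hyk
  have hyb : y ≠ b := by
    rintro rfl
    simp only [k, hsb] at hyk
    simp at hyk
  have hyI : y ∈ Set.Ioo a b :=
    ⟨lt_of_le_of_ne hy.1 (Ne.symm hya), lt_of_le_of_ne hy.2 hyb⟩
  have := htouch y (s + ε * (a + b - 2 * y)) (-ε) (by
    filter_upwards [Icc_mem_nhds hyI.1 hyI.2] with z hz
    have h3 : k z ≤ k y := hmax hz
    simp only [k] at h3
    nlinarith)
  linarith

theorem exists_affine_of_convexOn_concaveOn {h : ℝ → ℝ} (h1 : ConvexOn ℝ Set.univ h)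
    (h2 : ConcaveOn ℝ Set.univ h) : ∃ a b : ℝ, ∀ x, h x = a + b * x := by
  have key : ∀ x y s : ℝ, 0 ≤ s → s ≤ 1 → h ((1 - s) * x + s * y) = (1 - s) * h x + s * h y := by
    intro x y s hs hs1
    have e1 := h1.2 (Set.mem_univ x) (Set.mem_univ y) (by linarith : 0 ≤ 1 - s) hs (by ring)
    have e2 := h2.2 (Set.mem_univ x) (Set.mem_univ y) (by linarith : 0 ≤ 1 - s) hs (by ring)
    simp only [smul_eq_mul] at e1 e2
    linarith
  refine ⟨h 0, h 1 - h 0, fun x => ?_⟩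
  rcases le_total x 0 with hx | hx
  · -- `0` lies between `x` and `1`
    have hp : 0 < 1 - x := by linarith
    have := key x 1 (-x / (1 - x)) (div_nonneg (by linarith) hp.le)
      ((div_le_one hp).2 (by linarith))
    have e : (1 - -x / (1 - x)) * x + -x / (1 - x) * 1 = 0 := by field_simp; ring
    rw [e] at this
    field_simp at this
    linarith
  rcases le_total x 1 with hx1 | hx1
  · have := key 0 1 x hx hx1
    rw [show (1 - x) * 0 + x * 1 = x by ring] at this
    linarith
  · have hp : 0 < x := by linarith
    have := key 0 x (1 / x) (by positivity) ((div_le_one hp).2 hx1)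
    have e : (1 - 1 / x) * 0 + 1 / x * x = 1 := by field_simp; ring
    rw [e] at this
    field_simp at this
    linarith

/-- The second-order Taylor estimate of `u` at `y` needs no more than differentiability
of `u' = v` at `y`. -/
theorem eventually_taylor_two {u v : ℝ → ℝ} {y k ε : ℝ} (hu : ∀ x, HasDerivAt u (v x) x)
    (hv : HasDerivAt v k y) (hε : 0 < ε) :
    ∀ᶠ z in 𝓝 y, |u z - u y - v y * (z - y) - k / 2 * (z - y) ^ 2| ≤ ε * (z - y) ^ 2 := by
  have h1 := (hasDerivAt_iff_isLittleO.1 hv).def hε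
  obtain ⟨r, hr, hball⟩ := Metric.eventually_nhds_iff_ball.1 h1
  filter_upwards [Metric.ball_mem_nhds y hr] with z hz
  let w : ℝ → ℝ := fun s => u s - v y * (s - y) - k / 2 * (s - y) ^ 2
  have hw : ∀ s, HasDerivAt w (v s - v y - (s - y) * k) s := by
    intro s
    have h2 := ((hu s).sub (((hasDerivAt_id s).sub_const y).const_mul (v y))).sub
      ((((hasDerivAt_id s).sub_const y).pow 2).const_mul (k / 2))
    refine h2.congr_deriv ?_
    simp
    ring
  have hseg : ∀ s ∈ segment ℝ y z, s ∈ Metric.ball y r ∧ |s - y| ≤ |z - y| := by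
    intro s hs
    have hs' : dist s y ≤ dist z y := by
      obtain ⟨a, b, ha, hb, hab, rfl⟩ := hs
      have : a • y + b • z - y = b * (z - y) := by
        simp only [smul_eq_mul]
        have : a = 1 - b := by linarith
        rw [this]; ring
      rw [Real.dist_eq, Real.dist_eq, this, abs_mul, abs_of_nonneg hb]
      exact mul_le_of_le_one_left (abs_nonneg _) (by linarith)
    exact ⟨lt_of_le_of_lt hs' hz, hs'⟩
  have := (convex_segment (𝕜 := ℝ) y z).norm_image_sub_le_of_norm_hasDerivWithin_le
    (f := w) (f' := fun s => v s - v y - (s - y) * k) (C := ε * |z - y|)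
    (fun s _ => (hw s).hasDerivWithinAt)
    (fun s hs => by
      obtain ⟨hs1, hs2⟩ := hseg s hs
      have := hball s hs1
      simp only [smul_eq_mul, Real.norm_eq_abs] at this ⊢
      exact this.trans (by gcongr))
    (left_mem_segment ℝ y z) (right_mem_segment ℝ y z)
  simp only [w, Real.norm_eq_abs, sub_self, mul_zero] at this
  calc _ = |u z - v y * (z - y) - k / 2 * (z - y) ^ 2 - (u y - 0 - k / 2 * 0 ^ 2)| := by
        congr 1; ring
    _ ≤ _ := this
    _ = ε * (z - y) ^ 2 := by rw [mul_assoc, ← pow_two, sq_abs]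

/-- A continuous solution of `F'' / 2 = k`, in the sense of parabolas touching the graph of `F`
from above and from below, is continuously differentiable: `F` differs from a second primitive
of `2 k` by a function that is both convex and concave. -/
theorem contDiff_one_of_touching {F k : ℝ → ℝ} (hF : Continuous F) (hk : Continuous k)
    (hup : ∀ y p κ : ℝ, (∀ᶠ z in 𝓝 y, F z ≤ F y + p * (z - y) + κ * (z - y) ^ 2) → k y ≤ κ)
    (hlow : ∀ y p κ : ℝ, (∀ᶠ z in 𝓝 y, F y + p * (z - y) + κ * (z - y) ^ 2 ≤ F z) → κ ≤ k y) :
    ContDiff ℝ 1 F := by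
  let v : ℝ → ℝ := fun x => ∫ s in (0 : ℝ)..x, 2 * k s
  have hk2 : Continuous fun s => 2 * k s := by fun_prop
  have hv : ∀ x, HasDerivAt v (2 * k x) x := fun x =>
    hk2.integral_hasStrictDerivAt 0 x |>.hasDerivAt
  have hvc : Continuous v := continuous_iff_continuousAt.2 fun x => (hv x).continuousAt
  let u : ℝ → ℝ := fun x => ∫ s in (0 : ℝ)..x, v s
  have hu : ∀ x, HasDerivAt u (v x) x := fun x => hvc.integral_hasStrictDerivAt 0 x |>.hasDerivAt
  have huc : Continuous u := continuous_iff_continuousAt.2 fun x => (hu x).continuousAt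
  have hconv : ConvexOn ℝ Set.univ fun x => F x - u x := by
    refine convexOn_of_touching (hF.sub huc) fun y p κ ht => ?_
    refine le_of_forall_pos_le_add fun ε hε => ?_
    have := hup y (p + v y) (κ + k y + ε) (by
      filter_upwards [ht, eventually_taylor_two hu (hv y) hε] with z h1 h2
      have := (abs_le.1 h2).2
      nlinarith)
    linarith
  have hconc : ConcaveOn ℝ Set.univ fun x => F x - u x := by
    rw [← neg_convexOn_iff]
    refine convexOn_of_touching (hF.sub huc).neg fun y p κ ht => ?_
    refine le_of_forall_pos_le_add fun ε hε => ?_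
    have := hlow y (-p + v y) (-κ + k y - ε) (by
      filter_upwards [ht, eventually_taylor_two hu (hv y) hε] with z h1 h2
      have := (abs_le.1 h2).1
      simp only [Pi.neg_apply] at h1
      nlinarith)
    linarith
  obtain ⟨a, b, hab⟩ := exists_affine_of_convexOn_concaveOn hconv hconc
  have hFeq : F = fun x => a + b * x + u x := by
    funext x; have : F x - u x = _ := hab x; linarith
  have hu1 : ContDiff ℝ 1 u := by
    rw [contDiff_one_iff_deriv]
    refine ⟨fun x => (hu x).differentiableAt, ?_⟩
    rw [show deriv u = v from funext fun x => (hu x).deriv]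
    exact hvc
  rw [hFeq]
  fun_prop

/-! ### Moments of Gaussian increments and of stopped random walks -/

theorem integrable_pow_of_memLp_four {Ω : Type*} [MeasurableSpace Ω] {P : Measure Ω}
    [IsFiniteMeasure P] {X : Ω → ℝ} (hX : MemLp X 4 P) {a : ℕ} (ha : a ≤ 4) :
    Integrable (fun ω => X ω ^ a) P := by
  have h1 : MemLp X (a : ENNReal) P := hX.mono_exponent (by exact_mod_cast ha)
  have h2 : Integrable (fun ω => ‖X ω‖ ^ a) P := by
    rcases Nat.eq_zero_or_pos a with rfl | hpos
    · simp
    · exact h1.integrable_norm_pow hpos.ne'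
  exact h2.mono (hX.1.pow a) (ae_of_all _ fun ω => by simp)

/-- Scaling of the moments of a centred normal law. -/
theorem integral_pow_gaussianReal (v : ℝ≥0) (n : ℕ) :
    ∫ x, x ^ n ∂gaussianReal 0 v = (√v) ^ n * ∫ x, x ^ n ∂gaussianReal 0 1 := by
  have h : gaussianReal 0 v = (gaussianReal 0 1).map (fun x => √v * x) := by
    rw [gaussianReal_map_const_mul]
    congr 1
    · simp
    · ext; simp
  rw [h, integral_map (by fun_prop) (by fun_prop)]
  simp_rw [mul_pow]
  rw [integral_const_mul]

theorem integral_pow_gaussianReal_of_odd (v : ℝ≥0) {n : ℕ} (hn : Odd n) :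
    ∫ x, x ^ n ∂gaussianReal 0 v = 0 := by
  have h : gaussianReal 0 v = (gaussianReal 0 v).map (fun x => -x) := by
    rw [gaussianReal_map_neg, neg_zero]
  have h2 : ∫ x, x ^ n ∂gaussianReal 0 v = -∫ x, x ^ n ∂gaussianReal 0 v := by
    conv_lhs => rw [h, integral_map (by fun_prop) (by fun_prop)]
    simp_rw [hn.neg_pow]
    rw [integral_neg]
  linarith

theorem integral_sq_gaussianReal (v : ℝ≥0) : ∫ x, x ^ 2 ∂gaussianReal 0 v = v := by
  have := variance_fun_id_gaussianReal (μ := 0) (v := v)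
  rw [variance_eq_integral (by fun_prop)] at this
  simpa using this

/-- The fourth moment of the standard normal law; only its finiteness matters. -/
noncomputable def normalFourthMoment : ℝ := ∫ x, x ^ 4 ∂gaussianReal 0 1

theorem normalFourthMoment_nonneg : 0 ≤ normalFourthMoment :=
  integral_nonneg fun x => by positivity

section Walk

variable {Ω : Type*} {m0 : MeasurableSpace Ω} {P : Measure Ω}

/-- The moments of a walk whose centred increments `D j`, independent of the past `ℱ j`, are
added up on the events `E j` of the past only. -/
theorem moments_predictable_walk [IsProbabilityMeasure P] {ℱ : ℕ → MeasurableSpace Ω}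
    (hle : ∀ k, ℱ k ≤ m0) (hmono : Monotone ℱ) {D : ℕ → Ω → ℝ} {h : ℝ} (hh : 0 ≤ h)
    (hadapt : ∀ k, Measurable[ℱ (k + 1)] (D k))
    (hindep : ∀ k (X : Ω → ℝ), Measurable[ℱ k] X → IndepFun X (D k) P)
    (hL : ∀ k, MemLp (D k) 4 P) (h1 : ∀ k, ∫ ω, D k ω ∂P = 0) (h2 : ∀ k, ∫ ω, D k ω ^ 2 ∂P = h)
    (h3 : ∀ k, ∫ ω, D k ω ^ 3 ∂P = 0)
    (h4 : ∀ k, ∫ ω, D k ω ^ 4 ∂P = normalFourthMoment * h ^ 2)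
    {E : ℕ → Set Ω} (hE : ∀ k, MeasurableSet[ℱ k] (E k)) (n : ℕ) :
    MemLp (fun ω => ∑ j ∈ Finset.range n, (E j).indicator (D j) ω) 4 P ∧
    ∫ ω, ∑ j ∈ Finset.range n, (E j).indicator (D j) ω ∂P = 0 ∧
    ∫ ω, (∑ j ∈ Finset.range n, (E j).indicator (D j) ω) ^ 2 ∂P =
      h * ∑ j ∈ Finset.range n, P.real (E j) ∧
    ∫ ω, (∑ j ∈ Finset.range n, (E j).indicator (D j) ω) ^ 4 ∂P ≤
      (3 + normalFourthMoment) * (n * h) ^ 2 := by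
  set S : ℕ → Ω → ℝ := fun n ω => ∑ j ∈ Finset.range n, (E j).indicator (D j) ω with hS
  have hSm : ∀ n, Measurable[ℱ n] (S n) := by
    intro n
    refine Finset.measurable_fun_sum _ fun j hj => ?_
    have hj' : j + 1 ≤ n := Finset.mem_range.1 hj
    exact ((hadapt j).mono (hmono hj') le_rfl).indicator (hmono (j.le_succ.trans hj') _ (hE j))
  have hSL : ∀ n, MemLp (S n) 4 P := fun n =>
    memLp_finsetSum _ fun j _ => (hL j).indicator (hle j _ (hE j))
  change MemLp (S n) 4 P ∧ ∫ ω, S n ω ∂P = 0 ∧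
    ∫ ω, S n ω ^ 2 ∂P = h * ∑ j ∈ Finset.range n, P.real (E j) ∧
    ∫ ω, S n ω ^ 4 ∂P ≤ (3 + normalFourthMoment) * (n * h) ^ 2
  refine ⟨hSL n, ?_⟩
  induction n with
  | zero => simp [hS]
  | succ k ih =>
    obtain ⟨ih1, ih2, ih4⟩ := ih
    set e : Ω → ℝ := (E k).indicator 1 with he
    have hem : Measurable[ℱ k] e := Measurable.indicator (@measurable_const ℝ Ω _ (ℱ k) 1) (hE k)
    have hstep : ∀ ω, S (k + 1) ω = S k ω + e ω * D k ω := by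
      intro ω
      simp only [hS, Finset.sum_range_succ, he]
      by_cases hω : ω ∈ E k <;> simp [hω]
    have hee : ∀ ω, e ω = 0 ∨ e ω = 1 := by
      intro ω
      by_cases hω : ω ∈ E k <;> simp [he, hω]
    have hSe : ∀ a ≤ 4, Integrable (fun ω => S k ω ^ a * e ω) P := by
      intro a ha
      refine (integrable_pow_of_memLp_four (hSL k) ha).mono
        (((hSL k).1.pow a).mul (hem.mono (hle k) le_rfl).aestronglyMeasurable)
        (ae_of_all _ fun ω => ?_)
      rcases hee ω with h | h <;> simp [h]
    have hprod : ∀ a ≤ 4, ∀ b ≤ 4,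
        Integrable (fun ω => S k ω ^ a * e ω * D k ω ^ b) P ∧
        ∫ ω, S k ω ^ a * e ω * D k ω ^ b ∂P =
          (∫ ω, S k ω ^ a * e ω ∂P) * ∫ ω, D k ω ^ b ∂P := by
      intro a ha b hb
      have hX : Measurable[ℱ k] fun ω => S k ω ^ a * e ω := ((hSm k).pow_const a).mul hem
      have hi : IndepFun (fun ω => S k ω ^ a * e ω) (fun ω => D k ω ^ b) P :=
        (hindep k _ hX).comp measurable_id (measurable_id.pow_const b)
      have hD := integrable_pow_of_memLp_four (hL k) hb
      exact ⟨hi.integrable_mul (hSe a ha) hD,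
        hi.integral_mul_eq_mul_integral (hSe a ha).1 hD.1⟩
    have heP : ∫ ω, e ω ∂P = P.real (E k) := by
      rw [he, integral_indicator_one (hle k _ (hE k))]
    have hSp := fun {a : ℕ} (ha : a ≤ 4) => integrable_pow_of_memLp_four (hSL k) ha
    refine ⟨?_, ?_, ?_⟩
    · obtain ⟨i1, e1⟩ := hprod 0 (by norm_num) 1 (by norm_num)
      simp only [pow_zero, one_mul, pow_one, h1, mul_zero] at i1 e1
      simp_rw [hstep]
      rw [integral_add (by simpa using hSp (a := 1) (by norm_num)) i1, ih1, e1, add_zero]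
    · obtain ⟨i1, e1⟩ := hprod 1 (by norm_num) 1 (by norm_num)
      obtain ⟨i2, e2⟩ := hprod 0 (by norm_num) 2 (by norm_num)
      simp only [pow_zero, one_mul, pow_one, h1, h2, mul_zero, heP] at i1 e1 i2 e2
      have hexp : ∀ ω, S (k + 1) ω ^ 2 =
          S k ω ^ 2 + (2 * (S k ω * e ω * D k ω) + e ω * D k ω ^ 2) := by
        intro ω
        rw [hstep]
        rcases hee ω with h | h <;> rw [h] <;> ring
      simp_rw [hexp]
      have j1 : Integrable (fun ω => 2 * (S k ω * e ω * D k ω) + e ω * D k ω ^ 2) P :=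
        (i1.const_mul 2).add i2
      rw [integral_add (hSp (a := 2) (by norm_num)) j1, integral_add (i1.const_mul 2) i2,
        integral_const_mul, e1, e2, ih2, Finset.sum_range_succ]
      ring
    · obtain ⟨i1, e1⟩ := hprod 3 (by norm_num) 1 (by norm_num)
      obtain ⟨i2, e2⟩ := hprod 2 (by norm_num) 2 (by norm_num)
      obtain ⟨i3, e3⟩ := hprod 1 (by norm_num) 3 (by norm_num)
      obtain ⟨i4, e4⟩ := hprod 0 (by norm_num) 4 (by norm_num)
      simp only [pow_zero, one_mul, pow_one, h1, h2, h3, h4, mul_zero, heP]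
        at i1 e1 i2 e2 i3 e3 i4 e4
      have hexp : ∀ ω, S (k + 1) ω ^ 4 = S k ω ^ 4 + (4 * (S k ω ^ 3 * e ω * D k ω) +
          (6 * (S k ω ^ 2 * e ω * D k ω ^ 2) + (4 * (S k ω * e ω * D k ω ^ 3) +
            e ω * D k ω ^ 4))) := by
        intro ω
        rw [hstep]
        rcases hee ω with h | h <;> rw [h] <;> ring
      simp_rw [hexp]
      have j3 : Integrable (fun ω => 4 * (S k ω * e ω * D k ω ^ 3) + e ω * D k ω ^ 4) P :=
        (i3.const_mul 4).add i4
      have j2 : Integrable (fun ω => 6 * (S k ω ^ 2 * e ω * D k ω ^ 2) +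
          (4 * (S k ω * e ω * D k ω ^ 3) + e ω * D k ω ^ 4)) P := (i2.const_mul 6).add j3
      have j1 : Integrable (fun ω => 4 * (S k ω ^ 3 * e ω * D k ω) +
          (6 * (S k ω ^ 2 * e ω * D k ω ^ 2) +
            (4 * (S k ω * e ω * D k ω ^ 3) + e ω * D k ω ^ 4))) P := (i1.const_mul 4).add j2
      rw [integral_add (hSp le_rfl) j1, integral_add (i1.const_mul 4) j2,
        integral_add (i2.const_mul 6) j3,
        integral_add (i3.const_mul 4) i4, integral_const_mul, integral_const_mul,
        integral_const_mul, e1, e2, e3, e4]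
      have hsum : ∑ j ∈ Finset.range k, P.real (E j) ≤ k := by
        calc _ ≤ ∑ j ∈ Finset.range k, (1 : ℝ) := Finset.sum_le_sum fun j _ => measureReal_le_one
          _ = k := by simp
      have hle2 : ∫ ω, S k ω ^ 2 * e ω ∂P ≤ k * h := by
        calc _ ≤ ∫ ω, S k ω ^ 2 ∂P := by
              refine integral_mono (hSe 2 (by norm_num)) (hSp (by norm_num)) fun ω => ?_
              rcases hee ω with h | h <;> simp only [h] <;> nlinarith [sq_nonneg (S k ω)]
          _ = h * ∑ j ∈ Finset.range k, P.real (E j) := ih2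
          _ ≤ k * h := by rw [mul_comm]; gcongr
      have hM := normalFourthMoment_nonneg
      have hPE : P.real (E k) ≤ 1 := measureReal_le_one
      have b1 : (∫ ω, S k ω ^ 2 * e ω ∂P) * h ≤ k * h * h := by gcongr
      have b2 : P.real (E k) * (normalFourthMoment * h ^ 2) ≤ normalFourthMoment * h ^ 2 :=
        mul_le_of_le_one_left (by positivity) hPE
      have b3 : 0 ≤ normalFourthMoment * h ^ 2 * k := by positivity
      push_cast
      nlinarith [sq_nonneg h]

end Walk

/-! ### Brownian motion stopped along a grid -/

/-- A Brownian motion without exceptional null sets: every `B t` is measurable, and every path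
is continuous and starts at `0`. -/
structure IsRegularBrownian {Ω : Type*} [MeasurableSpace Ω] (B : ℝ≥0 → Ω → ℝ) (P : Measure Ω) :
    Prop extends IsPreBrownianReal B P where
  measurable : ∀ t, Measurable (B t)
  continuous : ∀ ω, Continuous (B · ω)
  zero : ∀ ω, B 0 ω = 0

/-- Every Brownian motion agrees, off a null set and at all times, with a regular one. -/
theorem exists_isRegularBrownian {Ω : Type*} [MeasurableSpace Ω] {P : Measure Ω}
    {B : ℝ≥0 → Ω → ℝ} (hB : IsBrownianReal B P) :
    ∃ B' : ℝ≥0 → Ω → ℝ, IsRegularBrownian B' P ∧ ∀ᵐ ω ∂P, ∀ t, B' t ω = B t ω := by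
  classical
  obtain ⟨q, hq⟩ := TopologicalSpace.exists_dense_seq ℝ≥0
  have hgood : ∀ᵐ ω ∂P, (Continuous (B · ω) ∧ B 0 ω = 0) ∧
      ∀ n, B (q n) ω = (hB.aemeasurable (q n)).mk _ ω :=
    (hB.cont.and hB.eval_zero_ae_eq_zero).and
      (ae_all_iff.2 fun n => (hB.aemeasurable (q n)).ae_eq_mk)
  obtain ⟨N, hN, hNm, hN0⟩ := exists_measurable_superset_of_null (ae_iff.1 hgood)
  have hNgood : ∀ ω, ω ∉ N → (Continuous (B · ω) ∧ B 0 ω = 0) ∧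
      ∀ n, B (q n) ω = (hB.aemeasurable (q n)).mk _ ω := fun ω hω => by
    by_contra hcon
    exact hω (hN hcon)
  set B' : ℝ≥0 → Ω → ℝ := fun t => Nᶜ.indicator (B t) with hB'
  have hae : ∀ᵐ ω ∂P, ∀ t, B' t ω = B t ω := by
    have : ∀ᵐ ω ∂P, ω ∉ N := measure_eq_zero_iff_ae_notMem.1 hN0
    filter_upwards [this] with ω hω t
    exact Set.indicator_of_mem (s := Nᶜ) hω _
  have hcont : ∀ ω, Continuous (B' · ω) := by
    intro ω
    by_cases hω : ω ∈ N
    · have : (B' · ω) = fun _ => 0 := by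
        funext t; exact Set.indicator_of_notMem (by simpa using hω) _
      rw [this]; exact continuous_const
    · have : (B' · ω) = (B · ω) := by
        funext t; exact Set.indicator_of_mem (s := Nᶜ) hω _
      rw [this]; exact (hNgood ω hω).1.1
  have hq_meas : ∀ n, Measurable (B' (q n)) := by
    intro n
    have : B' (q n) = Nᶜ.indicator ((hB.aemeasurable (q n)).mk _) := by
      funext ω
      by_cases hω : ω ∈ N
      · simp [hB', hω]
      · simp [hB', hω, (hNgood ω hω).2 n]
    rw [this]
    exact (hB.aemeasurable (q n)).measurable_mk.indicator hNm.compl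
  refine ⟨B', ⟨hB.toIsPreBrownianReal.congr fun t => ?_, fun t => ?_, hcont, fun ω => ?_⟩, hae⟩
  · filter_upwards [hae] with ω hω using (hω t).symm
  · have hcl : t ∈ closure (Set.range q) := hq t
    obtain ⟨u, hu, hut⟩ := mem_closure_iff_seq_limit.1 hcl
    refine measurable_of_tendsto_metrizable (f := fun n => B' (u n)) (fun n => ?_)
      (tendsto_pi_nhds.2 fun ω => ((hcont ω).tendsto t).comp hut)
    obtain ⟨k, hk⟩ := hu n
    rw [← hk]
    exact hq_meas k
  · by_cases hω : ω ∈ N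
    · simp [hB', hω]
    · simp [hB', hω, (hNgood ω hω).1.2]

/-- The `σ`-algebra generated by the path of `B` up to time `t`. -/
@[reducible] def pastField {Ω : Type*} (B : ℝ≥0 → Ω → ℝ) (t : ℝ≥0) : MeasurableSpace Ω :=
  MeasurableSpace.comap (fun ω (s : Set.Iic t) => B s ω) MeasurableSpace.pi

section Past

variable {Ω : Type*} {B : ℝ≥0 → Ω → ℝ}

theorem measurable_pastField {s t : ℝ≥0} (hst : s ≤ t) : Measurable[pastField B t] (B s) :=
  (measurable_pi_apply (⟨s, hst⟩ : Set.Iic t)).comp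
    (comap_measurable fun ω (r : Set.Iic t) => B r ω)

theorem pastField_mono : Monotone (pastField B) := by
  intro s t hst
  refine Measurable.comap_le (@measurable_pi_lambda _ _ _ (pastField B t) _ _ fun r => ?_)
  exact measurable_pastField ((show (r : ℝ≥0) ≤ s from r.2).trans hst)

/-- The number of grid times before `B` is stopped, times the mesh: the time at which a walk that
adds up increments over intervals of length `h` on the events `E s` comes to rest. -/
noncomputable def gridTime (h : ℝ≥0) (E : ℝ≥0 → Set Ω) (n : ℕ) (ω : Ω) : ℝ :=
  h * ∑ j ∈ Finset.range n, (E (j * h)).indicator 1 ω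

/-- The sum of the increments of `B` over the grid of mesh `h` on the events `E s`. -/
noncomputable def gridWalk (B : ℝ≥0 → Ω → ℝ) (h : ℝ≥0) (E : ℝ≥0 → Set Ω) (n : ℕ) (ω : Ω) : ℝ :=
  ∑ j ∈ Finset.range n,
    (E (j * h)).indicator (fun ω => B ((j + 1 : ℕ) * h) ω - B (j * h) ω) ω

/-- For decreasing events the walk is `B` at the grid time; it comes to rest at the first grid
point `N h` outside `E`, if there is one before step `n`. -/
theorem exists_gridWalk_eq (hB : ∀ ω, B 0 ω = 0) (h : ℝ≥0) {E : ℝ≥0 → Set Ω} (hE : Antitone E)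
    (n : ℕ) (ω : Ω) : ∃ N ≤ n, (∀ j < N, ω ∈ E (j * h)) ∧ (N < n → ω ∉ E (N * h)) ∧
      gridWalk B h E n ω = B (N * h) ω ∧ gridTime h E n ω = N * h := by
  induction n with
  | zero => exact ⟨0, le_rfl, by simp, by simp, by simp [gridWalk, hB], by simp [gridTime]⟩
  | succ n ih =>
    obtain ⟨N, hN, h1, h2, h3, h4⟩ := ih
    simp only [gridWalk, gridTime] at h3 h4
    by_cases hω : ω ∈ E (n * h)
    · have hNn : N = n := by
        by_contra hne
        have hlt : N < n := lt_of_le_of_ne hN hne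
        exact h2 hlt (hE (by gcongr) hω)
      subst hNn
      refine ⟨N + 1, le_rfl, fun j hj => ?_, by simp, ?_, ?_⟩
      · exact hE (by gcongr; omega) hω
      · simp only [gridWalk, Finset.sum_range_succ, h3, Set.indicator_of_mem hω]
        ring
      · simp only [gridTime, Finset.sum_range_succ, mul_add, h4, Set.indicator_of_mem hω]
        simp
        ring
    · refine ⟨N, hN.trans n.le_succ, h1, fun _ => ?_, ?_, ?_⟩
      · rcases hN.lt_or_eq with hlt | rfl
        · exact h2 hlt
        · exact hω
      · simpa [gridWalk, Finset.sum_range_succ, hω] using h3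
      · simp [gridTime, Finset.sum_range_succ, h4, hω]

variable [m0 : MeasurableSpace Ω] {P : Measure Ω}

theorem pastField_le (hB : ∀ t, Measurable (B t)) (t : ℝ≥0) : pastField B t ≤ m0 :=
  Measurable.comap_le (measurable_pi_lambda _ fun s => hB s)

theorem IsRegularBrownian.indepFun_increment (hB : IsRegularBrownian B P) {s t : ℝ≥0}
    (hst : s ≤ t) {X : Ω → ℝ} (hX : Measurable[pastField B s] X) :
    IndepFun X (fun ω => B t ω - B s ω) P := by
  have h1 := (hB.indepFun_shift s).symm.comp measurable_id
    (measurable_pi_apply (t - s) : Measurable fun w : ℝ≥0 → ℝ => w (t - s))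
  have h2 : ((fun w : ℝ≥0 → ℝ => w (t - s)) ∘ fun ω t => B (s + t) ω - B s ω) =
      fun ω => B t ω - B s ω := by
    funext ω
    simp [add_tsub_cancel_of_le hst]
  rw [h2] at h1
  refine indep_of_indep_of_le_left (IndepFun_iff_Indep _ _ _ |>.1 h1) ?_
  exact hX.comap_le

theorem IsRegularBrownian.hasLaw_increment (hB : IsRegularBrownian B P) {s t : ℝ≥0}
    (hst : s ≤ t) : HasLaw (fun ω => B t ω - B s ω) (gaussianReal 0 (t - s)) P := by
  have := hB.hasLaw_sub t s
  have e : nndist t.1 s.1 = t - s := by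
    ext
    rw [coe_nndist, Real.dist_eq, NNReal.coe_sub hst]
    exact abs_of_nonneg (sub_nonneg.2 (NNReal.coe_le_coe.2 hst))
  rw [e] at this
  exact this

theorem IsRegularBrownian.moments_gridWalk (hB : IsRegularBrownian B P) (h : ℝ≥0)
    {E : ℝ≥0 → Set Ω} (hE : ∀ s, MeasurableSet[pastField B s] (E s)) (n : ℕ) :
    MemLp (gridWalk B h E n) 4 P ∧ ∫ ω, gridWalk B h E n ω ∂P = 0 ∧
    ∫ ω, gridWalk B h E n ω ^ 2 ∂P = ∫ ω, gridTime h E n ω ∂P ∧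
    ∫ ω, gridWalk B h E n ω ^ 4 ∂P ≤ (3 + normalFourthMoment) * (n * h) ^ 2 := by
  have : IsProbabilityMeasure P := hB.isGaussianProcess.isProbabilityMeasure
  have hstep : ∀ k : ℕ, (k : ℝ≥0) * h ≤ (k + 1 : ℕ) * h := fun k => by gcongr; omega
  have hlaw : ∀ k : ℕ, HasLaw (fun ω => B ((k + 1 : ℕ) * h) ω - B (k * h) ω)
      (gaussianReal 0 h) P := fun k => by
    have := hB.hasLaw_increment (hstep k)
    rwa [show ((k + 1 : ℕ) : ℝ≥0) * h - k * h = h by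
      push_cast; rw [add_mul, one_mul, add_tsub_cancel_left]] at this
  have hmom : ∀ k n : ℕ, ∫ ω, (B ((k + 1 : ℕ) * h) ω - B (k * h) ω) ^ n ∂P =
      ∫ x, x ^ n ∂gaussianReal 0 h := fun k n =>
    (hlaw k).integral_comp (f := fun x : ℝ => x ^ n) (by fun_prop)
  have key := moments_predictable_walk (P := P) (ℱ := fun k : ℕ => pastField B (k * h))
    (D := fun k ω => B ((k + 1 : ℕ) * h) ω - B (k * h) ω) (h := h)
    (fun k => pastField_le hB.measurable _)
    (fun i j hij => pastField_mono (by gcongr)) h.2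
    (fun k => (measurable_pastField le_rfl).sub (measurable_pastField (hstep k)))
    (fun k X hX => hB.indepFun_increment (hstep k) hX)
    (fun k => (hlaw k).hasGaussianLaw.memLp (by simp))
    (fun k => by simpa using hmom k 1)
    (fun k => by rw [hmom, integral_sq_gaussianReal])
    (fun k => by rw [hmom, integral_pow_gaussianReal_of_odd _ (by decide)])
    (fun k => by
      rw [hmom, integral_pow_gaussianReal, normalFourthMoment, mul_comm]
      congr 1
      rw [show (√(h : ℝ)) ^ 4 = ((√(h : ℝ)) ^ 2) ^ 2 by ring, Real.sq_sqrt h.coe_nonneg])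
    (E := fun k => E (k * h)) (fun k => hE _) n
  obtain ⟨k1, k2, k3, k4⟩ := key
  refine ⟨k1, k2, k3.trans ?_, k4⟩
  simp only [gridTime]
  rw [integral_const_mul, integral_finsetSum]
  · congr 1
    refine Finset.sum_congr rfl fun j _ => ?_
    rw [integral_indicator_one (pastField_le hB.measurable _ _ (hE _))]
  · intro j _
    exact (integrable_const (1 : ℝ)).indicator (pastField_le hB.measurable _ _ (hE _))

end Past

/-! ### Brownian motion at a stopping time -/

section Stopping

variable {Ω : Type*} [m0 : MeasurableSpace Ω] {P : Measure Ω} {B : ℝ≥0 → Ω → ℝ}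

/-- An `L⁴` maximal inequality for Brownian motion, up to the value of the constant. -/
theorem IsRegularBrownian.measure_exists_lt_abs_le (hB : IsRegularBrownian B P) {c : ℝ≥0}
    (hc : 0 < c) {δ : ℝ} (hδ : 0 < δ) :
    P {ω | ∃ s ≤ c, δ < |B s ω|} ≤
      ENNReal.ofReal ((3 + normalFourthMoment) * (c : ℝ) ^ 2 / δ ^ 4) := by
  have hP : IsProbabilityMeasure P := hB.isGaussianProcess.isProbabilityMeasure
  -- exceedance at one of the points of the grid with `n` cells
  let A : ℕ → Set Ω := fun n => {ω | ∃ i ≤ n, δ < |B (i * (c / n)) ω|}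
  have hA : ∀ n ≠ 0, P (A n) ≤ ENNReal.ofReal ((3 + normalFourthMoment) * (c : ℝ) ^ 2 / δ ^ 4) := by
    intro n hn
    set h : ℝ≥0 := c / n with hh
    have hpos : 0 < h := by positivity
    let E : ℝ≥0 → Set Ω := fun s => {ω | ∀ i : ℕ, i * h ≤ s → |B (i * h) ω| ≤ δ}
    have hE : ∀ s, MeasurableSet[pastField B s] (E s) := by
      intro s
      have : E s = ⋂ (i : ℕ) (_ : i * h ≤ s), {ω | |B (i * h) ω| ≤ δ} := by ext; simp [E]
      rw [this]
      refine @MeasurableSet.iInter _ _ (pastField B s) _ _ fun i =>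
        @MeasurableSet.iInter _ _ (pastField B s) _ _ fun hi => ?_
      have h1 : Measurable[pastField B s] fun ω => |B (i * h) ω| :=
        continuous_abs.measurable.comp (measurable_pastField hi)
      exact h1 measurableSet_Iic
    have hanti : Antitone E := fun s t hst ω hω i hi => hω i (hi.trans hst)
    obtain ⟨k1, -, -, k4⟩ := hB.moments_gridWalk h hE n
    have hsub : A n ⊆ {ω | δ ^ 4 ≤ gridWalk B h E n ω ^ 4} := by
      rintro ω ⟨i, hin, hi⟩
      obtain ⟨N, hN, h1, h2, h3, -⟩ := exists_gridWalk_eq hB.zero h hanti n ω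
      have hNi : N ≤ i := by
        by_contra! hlt
        exact absurd (h1 i hlt i le_rfl) (not_le.2 hi)
      -- the walk comes to rest at the first exceedance
      have hex : δ < |B (N * h) ω| := by
        rcases hNi.eq_or_lt with rfl | hlt
        · exact hi
        · have := h2 (hlt.trans_le hin)
          simp only [E, Set.mem_ofPred_eq, not_forall, not_le] at this
          obtain ⟨j, hj, hj2⟩ := this
          have hjN : j ≤ N := by
            have := (mul_le_mul_iff_left₀ hpos).1 hj
            exact_mod_cast this
          rcases hjN.eq_or_lt with rfl | hlt'
          · exact hj2
          · exact absurd (h1 j hlt' j le_rfl) (not_le.2 hj2)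
      rw [Set.mem_ofPred_eq, h3, ← (show Even 4 by decide).pow_abs (B (N * h) ω)]
      gcongr
    have hi4 := integrable_pow_of_memLp_four k1 le_rfl
    have hmk := mul_meas_ge_le_integral_of_nonneg (μ := P) (ae_of_all _ fun ω => by positivity)
      hi4 (δ ^ 4)
    have hnh : (n : ℝ) * h = c := by
      rw [hh]; push_cast; field_simp
    rw [hnh] at k4
    calc P (A n) ≤ P {ω | δ ^ 4 ≤ gridWalk B h E n ω ^ 4} := measure_mono hsub
      _ = ENNReal.ofReal (P.real {ω | δ ^ 4 ≤ gridWalk B h E n ω ^ 4}) := by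
          rw [ofReal_measureReal]
      _ ≤ _ := by
          apply ENNReal.ofReal_le_ofReal
          rw [le_div_iff₀ (by positivity), mul_comm]
          exact hmk.trans k4
  have hsub : {ω | ∃ s ≤ c, δ < |B s ω|} ⊆ ⋃ N : ℕ, ⋂ n ≥ N + 1, A n := by
    rintro ω ⟨s, hs, hsδ⟩
    have hlim : Tendsto (fun n : ℕ => (⌊(s / c) * (n : ℝ≥0)⌋₊ : ℝ≥0) * (c / n)) atTop (𝓝 s) := by
      have h1 := (tendsto_nat_floor_mul_div_atTop (R := ℝ) (a := s / c) (by positivity)).comp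
        tendsto_natCast_atTop_atTop
      rw [← NNReal.tendsto_coe]
      have h2 := h1.mul_const (c : ℝ)
      rw [div_mul_cancel₀ _ (by positivity : (c : ℝ) ≠ 0)] at h2
      refine h2.congr fun n => ?_
      have e : ⌊(s / c) * (n : ℝ≥0)⌋₊ = ⌊((s : ℝ) / c) * (n : ℝ)⌋₊ := by
        exact (Nonneg.nat_floor_coe ((s / c) * (n : ℝ≥0))).symm
      simp only [Function.comp_apply, NNReal.coe_mul, NNReal.coe_natCast, NNReal.coe_div, e]
      ring
    have hev := ((hB.continuous ω).abs.tendsto s).comp hlim |>.eventually_const_lt hsδ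
    obtain ⟨N, hN⟩ := eventually_atTop.1 hev
    refine Set.mem_iUnion.2 ⟨N, Set.mem_iInter₂.2 fun n hn => ⟨_, ?_, hN n (by omega)⟩⟩
    refine Nat.floor_le_of_le ?_
    exact mul_le_of_le_one_left (zero_le) (div_le_one_of_le₀ hs (zero_le))
  refine (measure_mono hsub).trans ?_
  have hmono : Monotone fun N : ℕ => ⋂ n ≥ N + 1, A n := by
    intro M N hMN
    exact Set.biInter_subset_biInter_left fun n (hn : N + 1 ≤ n) =>
      show M + 1 ≤ n by omega
  refine le_of_tendsto' (tendsto_measure_iUnion_atTop hmono) fun N => ?_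
  exact (measure_mono (Set.biInter_subset_of_mem (le_refl (N + 1)))).trans (hA _ (by omega))

/-- If `Φ` is dominated by a polynomial without cubic term, then the mean of `Φ` at Brownian
motion stopped before time `c` is dominated as well: the stopped path is centred, its second
moment is the mean of the stopping time, and its fourth moment is of order `c²`. -/
theorem IsRegularBrownian.integral_stopped_le (hB : IsRegularBrownian B P) {c : ℝ≥0}
    {E : ℝ≥0 → Set Ω} (hE : ∀ s, MeasurableSet[pastField B s] (E s)) (hanti : Antitone E)
    {θ : Ω → ℝ≥0} (hθc : ∀ ω, θ ω ≤ c) (hθ1 : ∀ ω, ∀ s < θ ω, ω ∈ E s)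
    (hθ2 : ∀ ω s, θ ω < s → s ≤ c → ω ∉ E s) {Φ : ℝ → ℝ} (hΦ : Continuous Φ) {M : ℝ}
    (hM : ∀ x, |Φ x| ≤ M) {p κ K : ℝ} (hK : 0 ≤ K)
    (hpoly : ∀ x, Φ x ≤ Φ 0 + p * x + κ * x ^ 2 + K * x ^ 4) :
    Measurable θ ∧ Measurable (fun ω => B (θ ω) ω) ∧
    ∫ ω, Φ (B (θ ω) ω) ∂P ≤
      Φ 0 + κ * ∫ ω, (θ ω : ℝ) ∂P + K * ((3 + normalFourthMoment) * (c : ℝ) ^ 2) := by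
  have hP : IsProbabilityMeasure P := hB.isGaussianProcess.isProbabilityMeasure
  let h : ℕ → ℝ≥0 := fun n => c / (n + 1 : ℕ)
  have hnh : ∀ n : ℕ, ((n + 1 : ℕ) : ℝ≥0) * h n = c := fun n => by
    simp only [h]; field_simp
  have hh0 : Tendsto h atTop (𝓝 0) := by
    rw [← NNReal.tendsto_coe]
    have := tendsto_const_div_atTop_nhds_zero_nat (c : ℝ)
    exact (this.comp (tendsto_add_atTop_nat 1)).congr fun n => by simp [h]
  have hEm : ∀ s, MeasurableSet (E s) := fun s => pastField_le hB.measurable _ _ (hE s)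
  -- the grid stopping times `τ n` approximate `θ` with an error below the mesh
  have hτ : ∀ ω n, ∃ τ : ℝ≥0, τ ≤ c ∧ τ ≤ θ ω + h n ∧ θ ω ≤ τ ∧
      gridWalk B (h n) E (n + 1) ω = B τ ω ∧ gridTime (h n) E (n + 1) ω = τ := by
    intro ω n
    obtain ⟨N, hN, h1, h2, h3, h4⟩ := exists_gridWalk_eq hB.zero (h n) hanti (n + 1) ω
    have hNc : (N : ℝ≥0) * h n ≤ c := by
      rw [← hnh n]; gcongr
    refine ⟨N * h n, hNc, ?_, ?_, h3, by rw [h4]; push_cast; rfl⟩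
    · rcases N with _ | N
      · simp
      · have h5 : (N : ℝ≥0) * h n ≤ θ ω := by
          by_contra! hlt
          exact hθ2 ω _ hlt (le_trans (by gcongr; omega) hNc) (h1 N (by omega))
        push_cast
        rw [add_mul, one_mul]
        gcongr
    · rcases hN.lt_or_eq with hlt | rfl
      · by_contra! hlt'
        exact h2 hlt (hθ1 ω _ hlt')
      · rw [hnh]; exact hθc ω
  choose τ hτc hτ1 hτ2 hτw hτt using hτ
  have hτlim : ∀ ω, Tendsto (τ ω) atTop (𝓝 (θ ω)) := by
    intro ω
    refine tendsto_of_tendsto_of_tendsto_of_le_of_le tendsto_const_nhds ?_ (hτ2 ω) (hτ1 ω)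
    simpa using tendsto_const_nhds.add hh0
  have hgt : ∀ ω, Tendsto (fun n => gridTime (h n) E (n + 1) ω) atTop (𝓝 (θ ω)) := fun ω => by
    simp_rw [hτt]
    exact (NNReal.tendsto_coe.2 (hτlim ω))
  have hgw : ∀ ω, Tendsto (fun n => gridWalk B (h n) E (n + 1) ω) atTop (𝓝 (B (θ ω) ω)) := by
    intro ω
    simp_rw [hτw]
    exact ((hB.continuous ω).tendsto _).comp (hτlim ω)
  have hgtm : ∀ n, Measurable (gridTime (Ω := Ω) (h n) E (n + 1)) := fun n => by
    unfold gridTime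
    exact (Finset.measurable_fun_sum _ fun j _ => measurable_one.indicator (hEm _)).const_mul _
  have hgwm : ∀ n, Measurable (gridWalk B (h n) E (n + 1)) := fun n => by
    unfold gridWalk
    exact Finset.measurable_fun_sum _ fun j _ =>
      ((hB.measurable _).sub (hB.measurable _)).indicator (hEm _)
  have hθm : Measurable fun ω => (θ ω : ℝ) :=
    measurable_of_tendsto_metrizable hgtm (tendsto_pi_nhds.2 hgt)
  have hBm : Measurable fun ω => B (θ ω) ω :=
    measurable_of_tendsto_metrizable hgwm (tendsto_pi_nhds.2 hgw)
  refine ⟨by simpa using hθm.real_toNNReal, hBm, ?_⟩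
  have hl1 : Tendsto (fun n => ∫ ω, Φ (gridWalk B (h n) E (n + 1) ω) ∂P) atTop
      (𝓝 (∫ ω, Φ (B (θ ω) ω) ∂P)) :=
    tendsto_integral_of_dominated_convergence (fun _ => M)
      (fun n => (hΦ.measurable.comp (hgwm n)).aestronglyMeasurable) (integrable_const _)
      (fun n => ae_of_all _ fun ω => hM _)
      (ae_of_all _ fun ω => (hΦ.tendsto _).comp (hgw ω))
  have hl2 : Tendsto (fun n => ∫ ω, gridTime (h n) E (n + 1) ω ∂P) atTop
      (𝓝 (∫ ω, (θ ω : ℝ) ∂P)) :=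
    tendsto_integral_of_dominated_convergence (fun _ => (c : ℝ))
      (fun n => (hgtm n).aestronglyMeasurable) (integrable_const _)
      (fun n => ae_of_all _ fun ω => by
        rw [hτt, Real.norm_of_nonneg (NNReal.coe_nonneg _)]
        exact_mod_cast hτc ω n)
      (ae_of_all _ hgt)
  refine le_of_tendsto_of_tendsto' hl1
    (((hl2.const_mul κ).const_add (Φ 0)).add_const (K * ((3 + normalFourthMoment) * (c : ℝ) ^ 2)))
    fun n => ?_
  obtain ⟨k1, k2, k3, k4⟩ := hB.moments_gridWalk (h n) hE (n + 1)
  have hn' : ((n + 1 : ℕ) : ℝ) * (h n : ℝ) = c := by exact_mod_cast hnh n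
  rw [hn'] at k4
  set S := gridWalk B (h n) E (n + 1)
  have i1 : Integrable S P := by simpa using integrable_pow_of_memLp_four k1 (a := 1) (by norm_num)
  have i2 := integrable_pow_of_memLp_four k1 (a := 2) (by norm_num)
  have i4 := integrable_pow_of_memLp_four k1 (a := 4) (by norm_num)
  have j1 : Integrable (fun ω => Φ 0 + p * S ω) P := (integrable_const _).add (i1.const_mul p)
  have j2 : Integrable (fun ω => Φ 0 + p * S ω + κ * S ω ^ 2) P := j1.add (i2.const_mul κ)
  calc ∫ ω, Φ (S ω) ∂P ≤ ∫ ω, (Φ 0 + p * S ω + κ * S ω ^ 2 + K * S ω ^ 4) ∂P := by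
        refine integral_mono ?_ (j2.add (i4.const_mul K)) fun ω => hpoly _
        exact Integrable.of_bound (hΦ.measurable.comp (hgwm n)).aestronglyMeasurable M
          (ae_of_all _ fun ω => hM _)
    _ = Φ 0 + κ * ∫ ω, gridTime (h n) E (n + 1) ω ∂P + K * ∫ ω, S ω ^ 4 ∂P := by
        rw [integral_add j2 (i4.const_mul K), integral_add j1 (i2.const_mul κ),
          integral_add (integrable_const _) (i1.const_mul p), integral_const_mul,
          integral_const_mul, integral_const_mul, k2, k3]
        simp
    _ ≤ _ := by gcongr

end Stopping

namespace Brox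

/-! ### Scale function, clock and inverse clock -/

variable {W : ℝ → ℝ}

theorem scale_hasDerivAt (hW : Continuous W) (x : ℝ) :
    HasDerivAt (scale W) (Real.exp (W x)) x :=
  ((Real.continuous_exp.comp hW).integral_hasStrictDerivAt 0 x).hasDerivAt

theorem contDiff_scale (hW : Continuous W) : ContDiff ℝ 1 (scale W) := by
  rw [contDiff_one_iff_deriv]
  refine ⟨fun x => (scale_hasDerivAt hW x).differentiableAt, ?_⟩
  rw [show deriv (scale W) = fun x => Real.exp (W x) from
    funext fun x => (scale_hasDerivAt hW x).deriv]
  exact Real.continuous_exp.comp hW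

theorem IsEnvironment.scale_scaleInv (hW : IsEnvironment W) (z : ℝ) :
    scale W (scaleInv W z) = z :=
  Function.rightInverse_invFun hW.surjective_scale z

theorem IsEnvironment.scaleInv_scale (hW : IsEnvironment W) (x : ℝ) :
    scaleInv W (scale W x) = x :=
  Function.leftInverse_invFun hW.scale_bijective.injective x

theorem IsEnvironment.continuous_scaleInv (hW : IsEnvironment W) : Continuous (scaleInv W) := by
  refine Monotone.continuous_of_surjective (fun a b hab => ?_)
    fun x => ⟨_, hW.scaleInv_scale x⟩
  rwa [← (scale_strictMono hW.continuous).le_iff_le, hW.scale_scaleInv, hW.scale_scaleInv]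

/-- The speed density `m = e^{-2 W ∘ A⁻¹}` in the scale coordinate: the integrand of the clock. -/
noncomputable def speed (W : ℝ → ℝ) (z : ℝ) : ℝ := Real.exp (-2 * W (scaleInv W z))

theorem speed_pos (z : ℝ) : 0 < speed W z := Real.exp_pos _

theorem IsEnvironment.continuous_speed (hW : IsEnvironment W) : Continuous (speed W) :=
  Real.continuous_exp.comp (continuous_const.mul (hW.continuous.comp hW.continuous_scaleInv))

section Path

variable {b : ℝ≥0 → ℝ}

theorem clock_eq (b : ℝ≥0 → ℝ) (u : ℝ) :
    clock W b u = ∫ s in (0 : ℝ)..u, speed W (b s.toNNReal) := rfl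

theorem IsEnvironment.continuous_speed_path (hW : IsEnvironment W) (hb : Continuous b) :
    Continuous fun s : ℝ => speed W (b s.toNNReal) :=
  hW.continuous_speed.comp (hb.comp continuous_real_toNNReal)

theorem IsEnvironment.continuous_clock (hW : IsEnvironment W) (hb : Continuous b) :
    Continuous (clock W b) :=
  intervalIntegral.continuous_primitive
    (fun _ _ => (hW.continuous_speed_path hb).intervalIntegrable _ _) 0

theorem IsEnvironment.strictMono_clock (hW : IsEnvironment W) (hb : Continuous b) :
    StrictMono (clock W b) := by
  intro u v huv
  have hc := hW.continuous_speed_path hb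
  have h := intervalIntegral.intervalIntegral_pos_of_pos (hc.intervalIntegrable u v)
    (fun s => speed_pos (W := W) (b s.toNNReal)) huv
  have h2 := intervalIntegral.integral_add_adjacent_intervals
    (hc.intervalIntegrable (μ := volume) 0 u) (hc.intervalIntegrable (μ := volume) u v)
  rw [clock_eq, clock_eq]
  linarith

theorem clock_zero (b : ℝ≥0 → ℝ) : clock W b 0 = 0 := by simp [clock]

theorem IsEnvironment.clockInv_eq (hW : IsEnvironment W) (hb : Continuous b) {t u : ℝ}
    (hu : 0 ≤ u) (htu : clock W b u = t) : clockInv W b t = u := by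
  have : {v : ℝ | 0 ≤ v ∧ t ≤ clock W b v} = Set.Ici u := by
    ext v
    simp only [Set.mem_ofPred_eq, Set.mem_Ici, ← htu, (hW.strictMono_clock hb).le_iff_le]
    exact ⟨fun h => h.2, fun h => ⟨hu.trans h, h⟩⟩
  rw [clockInv, this, csInf_Ici]

/-- The inverse clock, cut off at time `c`. The cutoff makes it a bounded stopping time, and gives
it a value also when the clock never reaches `t`, where `clockInv` takes the junk value `0`. -/
theorem IsEnvironment.exists_clock_cutoff (hW : IsEnvironment W) (hb : Continuous b) {t : ℝ}
    (ht : 0 < t) (c : ℝ≥0) : ∃ θ : ℝ≥0, θ ≤ c ∧ (∀ s < θ, clock W b s < t) ∧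
      (∀ s, θ < s → s ≤ c → ¬ clock W b s < t) ∧
      (t ≤ clock W b c → clock W b θ = t ∧ clockInv W b t = θ) := by
  have hmono := hW.strictMono_clock hb
  by_cases hc : t ≤ clock W b c
  · obtain ⟨u, hu, hut⟩ := intermediate_value_Icc c.coe_nonneg
      (hW.continuous_clock hb).continuousOn ⟨(clock_zero (W := W) b).le.trans ht.le, hc⟩
    refine ⟨⟨u, hu.1⟩, hu.2, fun s hs => ?_, fun s hs _ => ?_, fun _ => ⟨hut, ?_⟩⟩
    · rw [← hut]; exact hmono hs
    · rw [← hut, not_lt]; exact (hmono hs).le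
    · exact hW.clockInv_eq hb hu.1 hut
  · push Not at hc
    exact ⟨c, le_rfl, fun s hs => (hmono hs).trans hc, fun s hs hsc => absurd hs (not_lt.2 hsc),
      fun h => absurd h (not_le.2 hc)⟩

theorem IsEnvironment.clock_mem_Icc (hW : IsEnvironment W) (hb : Continuous b) {l r : ℝ}
    {θ : ℝ≥0} (h : ∀ s ≤ θ, speed W (b s) ∈ Set.Icc l r) :
    clock W b θ ∈ Set.Icc (l * θ) (r * θ) := by
  have hi := (hW.continuous_speed_path hb).intervalIntegrable (μ := volume) 0 θ
  have hmem : ∀ s ∈ Set.Icc (0 : ℝ) θ, speed W (b s.toNNReal) ∈ Set.Icc l r := fun s hs =>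
    h _ (Real.toNNReal_le_iff_le_coe.2 hs.2)
  constructor
  · have := intervalIntegral.integral_mono_on θ.coe_nonneg
      (intervalIntegrable_const (c := l)) hi fun s hs => (hmem s hs).1
    simpa [clock_eq, mul_comm] using this
  · have := intervalIntegral.integral_mono_on θ.coe_nonneg hi
      (intervalIntegrable_const (c := r)) fun s hs => (hmem s hs).2
    simpa [clock_eq, mul_comm] using this

end Path

theorem measurable_intervalIntegral_of_continuous {Ω : Type*} [MeasurableSpace Ω]
    {u : ℝ → Ω → ℝ} (hc : ∀ ω, Continuous fun s => u s ω) (hm : ∀ s, Measurable (u s))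
    {a : ℝ} (ha : 0 ≤ a) : Measurable fun ω => ∫ s in (0 : ℝ)..a, u s ω := by
  simp_rw [intervalIntegral.integral_of_le ha]
  have h := measurable_uncurry_of_continuous_of_measurable hc hm
  exact (h.stronglyMeasurable.integral_prod_left (μ := volume.restrict (Set.Ioc 0 a))).measurable

variable {Ω : Type*} {B : ℝ≥0 → Ω → ℝ}

/-- The clock at time `s` depends on the path up to time `s` only. -/
theorem IsEnvironment.measurable_clock (hW : IsEnvironment W) (hB : ∀ ω, Continuous (B · ω))
    (y : ℝ) (s : ℝ≥0) :
    Measurable[pastField B s] fun ω => clock W (fun r => y + B r ω) s := by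
  have hst : (fun ω => clock W (fun r => y + B r ω) s) = fun ω =>
      ∫ r in (0 : ℝ)..s, speed W (y + B (min r.toNNReal s) ω) := by
    funext ω
    refine intervalIntegral.integral_congr fun r hr => ?_
    rw [Set.uIcc_of_le s.coe_nonneg] at hr
    simp only [min_eq_left (Real.toNNReal_le_iff_le_coe.2 hr.2), speed]
  rw [hst]
  refine @measurable_intervalIntegral_of_continuous Ω (pastField B s) _ (fun ω => ?_)
    (fun r => ?_) _ s.coe_nonneg
  · exact hW.continuous_speed.comp (continuous_const.add ((hB ω).comp
      (continuous_real_toNNReal.min continuous_const)))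
  · exact (hW.continuous_speed.comp (continuous_const_add y)).measurable.comp
      (measurable_pastField (min_le_right _ _))

variable [MeasurableSpace Ω] {P : Measure Ω}

theorem measurable_process (hB : IsRegularBrownian B P) (hW : IsEnvironment W) (x : ℝ) {t : ℝ}
    (ht : 0 < t) : Measurable (process B W x t) := by
  have hb : ∀ ω, Continuous fun r => scale W x + B r ω := fun ω =>
    continuous_const.add (hB.continuous ω)
  choose θ hθc hθ1 hθ2 hθ3 using fun (n : ℕ) ω => hW.exists_clock_cutoff (hb ω) ht (n : ℝ≥0)
  let E : ℝ≥0 → Set Ω := fun s => {ω | clock W (fun r => scale W x + B r ω) s < t}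
  have hE : ∀ s, MeasurableSet[pastField B s] (E s) := fun s =>
    hW.measurable_clock hB.continuous _ s measurableSet_Iio
  have hanti : Antitone E := fun s r hsr ω hω =>
    ((hW.strictMono_clock (hb ω)).monotone (NNReal.coe_le_coe.2 hsr)).trans_lt hω
  have hm : ∀ n : ℕ, Measurable fun ω => B (θ n ω) ω := fun n =>
    (hB.integral_stopped_le hE hanti (hθc n) (hθ1 n) (hθ2 n) (Φ := fun _ => 0)
      continuous_const (M := 0) (by simp) (p := 0) (κ := 0) (K := 0) le_rfl (by simp)).2.1
  have hEm : ∀ s, MeasurableSet (E s) := fun s => pastField_le hB.measurable _ _ (hE s)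
  -- the process is the eventually constant limit of its versions stopped at integer times
  have hX : ∀ n : ℕ, Measurable fun ω =>
      scaleInv W (scale W x + (E n)ᶜ.indicator (fun ω => B (θ n ω) ω) ω) := fun n =>
    (hW.continuous_scaleInv.comp (continuous_const_add (scale W x))).measurable.comp
      ((hm n).indicator (hEm n).compl)
  refine measurable_of_tendsto_metrizable hX (tendsto_pi_nhds.2 fun ω => ?_)
  refine tendsto_const_nhds.congr' ?_
  by_cases hex : ∃ n : ℕ, t ≤ clock W (fun r => scale W x + B r ω) n
  · obtain ⟨n, hn⟩ := hex
    filter_upwards [eventually_ge_atTop n] with k hk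
    have hk' : t ≤ clock W (fun r => scale W x + B r ω) ((k : ℝ≥0) : ℝ) :=
      hn.trans ((hW.strictMono_clock (hb ω)).monotone (by simpa using hk))
    have hωk : ω ∈ (E k)ᶜ := by simpa [E] using hk'
    rw [Set.indicator_of_mem hωk, process, timeChange, (hθ3 k ω hk').2, Real.toNNReal_coe]
  · push Not at hex
    refine Eventually.of_forall fun k => ?_
    have hωk : ω ∉ (E k)ᶜ := by simpa [E] using hex k
    have hempty : {u : ℝ | 0 ≤ u ∧ t ≤ clock W (fun r => scale W x + B r ω) u} = ∅ := by
      refine Set.eq_empty_of_forall_notMem fun u hu => ?_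
      obtain ⟨k, hk⟩ := exists_nat_ge u
      exact absurd (hu.2.trans ((hW.strictMono_clock (hb ω)).monotone hk)) (not_le.2 (hex k))
    beta_reduce
    rw [Set.indicator_of_notMem hωk, process, timeChange, clockInv, hempty, Real.sInf_empty,
      Real.toNNReal_zero, hB.zero]

/-! ### The generator at a touching parabola -/

/-- The short-time estimate behind `generator_le_of_touching`: if `f` lies below a parabola with
leading coefficient `κ` in the scale coordinate near `x`, then `H_t f(x) - f(x)` is at most
`κ t / m`, up to `O(t²)` and the oscillation of `1 / m`. -/
theorem exists_semigroup_sub_le (hB : IsRegularBrownian B P) (hW : IsEnvironment W)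
    (f : C₀(ℝ, ℝ)) (x : ℝ) {p κ δ l r : ℝ} (hδ : 0 < δ) (hl : 0 < l)
    (hlr : ∀ z, |z - scale W x| ≤ δ → speed W z ∈ Set.Icc l r)
    (htouch : ∀ z, |z - scale W x| ≤ δ →
      f (scaleInv W z) ≤ f x + p * (z - scale W x) + κ * (z - scale W x) ^ 2) :
    ∃ C : ℝ, ∀ t, 0 < t → t ≤ 1 → semigroup B P W t f x - f x ≤
      t * (κ / speed W (scale W x) + |κ| * (1 / l - 1 / r) + C * t) := by
  have hP : IsProbabilityMeasure P := hB.isGaussianProcess.isProbabilityMeasure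
  obtain ⟨M, hM⟩ : ∃ M, ∀ z, |f z| ≤ M :=
    ⟨‖f.toBCF‖, fun z => by simpa using f.toBCF.norm_coe_le_norm z⟩
  have hM0 : 0 ≤ M := (abs_nonneg _).trans (hM 0)
  set y := scale W x with hy
  set m := speed W y with hm
  have hmlr : m ∈ Set.Icc l r := hlr y (by simpa using hδ.le)
  have hm0 : 0 < m := speed_pos y
  have hr : 0 < r := hl.trans_le (hmlr.1.trans hmlr.2)
  set Q := 3 + normalFourthMoment with hQ
  have hQ0 : 0 ≤ Q := by have := normalFourthMoment_nonneg; positivity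
  -- away from `y` the bounded function `f` is below a quartic
  set K := |p| / δ ^ 3 + |κ| / δ ^ 2 + 2 * M / δ ^ 4 with hK
  have hK0 : 0 ≤ K := by positivity
  set Φ : ℝ → ℝ := fun z => f (scaleInv W (y + z)) with hΦ
  have hΦc : Continuous Φ :=
    f.continuous.comp (hW.continuous_scaleInv.comp (continuous_const_add y))
  have hΦ0 : Φ 0 = f x := by simp [hΦ, hy, hW.scaleInv_scale]
  have hpoly : ∀ z, Φ z ≤ Φ 0 + p * z + κ * z ^ 2 + K * z ^ 4 := by
    intro z
    rw [hΦ0]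
    by_cases hz : |z| ≤ δ
    · have := htouch (y + z) (by simpa using hz)
      simp only [add_sub_cancel_left] at this
      have h4 : 0 ≤ K * z ^ 4 := by positivity
      simp only [hΦ]
      linarith
    · push Not at hz
      have hδz : 1 ≤ |z| / δ := (one_le_div hδ).2 hz.le
      have e1 : -(|p| / δ ^ 3 * z ^ 4) ≤ p * z := by
        have h1 : |p * z| ≤ |p| / δ ^ 3 * z ^ 4 := by
          calc |p * z| = |p| * |z| * 1 := by rw [abs_mul, mul_one]
            _ ≤ |p| * |z| * (|z| / δ) ^ 3 := by gcongr; exact one_le_pow₀ hδz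
            _ = |p| / δ ^ 3 * |z| ^ 4 := by ring
            _ = _ := by rw [(show Even 4 by decide).pow_abs]
        linarith [neg_abs_le (p * z)]
      have e2 : -(|κ| / δ ^ 2 * z ^ 4) ≤ κ * z ^ 2 := by
        have h1 : |κ * z ^ 2| ≤ |κ| / δ ^ 2 * z ^ 4 := by
          calc |κ * z ^ 2| = |κ| * |z| ^ 2 * 1 := by rw [abs_mul, abs_pow, mul_one]
            _ ≤ |κ| * |z| ^ 2 * (|z| / δ) ^ 2 := by gcongr; exact one_le_pow₀ hδz
            _ = |κ| / δ ^ 2 * |z| ^ 4 := by ring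
            _ = _ := by rw [(show Even 4 by decide).pow_abs]
        linarith [neg_abs_le (κ * z ^ 2)]
      have e3 : 2 * M ≤ 2 * M / δ ^ 4 * z ^ 4 := by
        calc 2 * M = 2 * M * 1 := by ring
          _ ≤ 2 * M * (|z| / δ) ^ 4 := by gcongr; exact one_le_pow₀ hδz
          _ = 2 * M / δ ^ 4 * |z| ^ 4 := by ring
          _ = _ := by rw [(show Even 4 by decide).pow_abs]
      have h5 := (abs_le.1 (hM (scaleInv W (y + z)))).2
      have h6 := (abs_le.1 (hM x)).1
      simp only [hΦ, hK]
      nlinarith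
  refine ⟨K * Q / l ^ 2 + 2 * M * (Q / (l ^ 2 * δ ^ 4)) + |κ| / l * (Q / (l ^ 2 * δ ^ 4)),
    fun t ht ht1 => ?_⟩
  have hb : ∀ ω, Continuous fun r => y + B r ω := fun ω => continuous_const.add (hB.continuous ω)
  set c : ℝ≥0 := ⟨t / l, by positivity⟩ with hc
  have hcv : (c : ℝ) = t / l := rfl
  have hc0 : 0 < c := by rw [← NNReal.coe_pos, hcv]; positivity
  choose θ hθc hθ1 hθ2 hθ3 using fun ω => hW.exists_clock_cutoff (hb ω) ht c
  let E : ℝ≥0 → Set Ω := fun s => {ω | clock W (fun r => y + B r ω) s < t}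
  obtain ⟨hθm, -, hmain⟩ := hB.integral_stopped_le (E := E)
    (fun s => hW.measurable_clock hB.continuous _ s measurableSet_Iio)
    (fun s r hsr ω hω =>
      ((hW.strictMono_clock (hb ω)).monotone (NNReal.coe_le_coe.2 hsr)).trans_lt hω)
    hθc hθ1 hθ2 hΦc (fun z => hM _) hK0 hpoly
  -- the exceptional event on which the path leaves the window of size `δ` too early
  set bad := toMeasurable P {ω | ∃ s ≤ c, δ < |B s ω|} with hbad
  have hbadm : MeasurableSet bad := measurableSet_toMeasurable _ _
  have hPbad : P.real bad ≤ Q / (l ^ 2 * δ ^ 4) * t ^ 2 := by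
    have h1 := hB.measure_exists_lt_abs_le hc0 hδ
    rw [← measure_toMeasurable] at h1
    refine ENNReal.toReal_le_of_le_ofReal (by positivity) (h1.trans_eq ?_)
    rw [hcv, ← hQ]
    congr 1
    field_simp
  have hgood : ∀ ω, ω ∉ bad → process B W x t ω = scaleInv W (y + B (θ ω) ω) ∧
      t / r ≤ θ ω := by
    intro ω hω
    have hω' : ∀ s ≤ c, |B s ω| ≤ δ := by
      intro s hs
      by_contra! hlt
      exact hω (subset_toMeasurable _ _ ⟨s, hs, hlt⟩)
    have hsp : ∀ s ≤ c, speed W (y + B s ω) ∈ Set.Icc l r := fun s hs =>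
      hlr _ (by simpa using hω' s hs)
    have htc : t ≤ clock W (fun r => y + B r ω) c := by
      have := (hW.clock_mem_Icc (hb ω) hsp).1
      rwa [hcv, mul_div_cancel₀ _ hl.ne'] at this
    obtain ⟨h1, h2⟩ := hθ3 ω htc
    refine ⟨?_, ?_⟩
    · rw [process, timeChange, h2, Real.toNNReal_coe]
    · have := (hW.clock_mem_Icc (hb ω) fun s hs => hsp s (hs.trans (hθc ω))).2
      rw [h1] at this
      rwa [div_le_iff₀ hr, mul_comm]
  have hθle : ∀ ω, (θ ω : ℝ) ≤ t / l := fun ω => by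
    rw [← hcv]; exact_mod_cast hθc ω
  have hΦi : Integrable (fun ω => Φ (B (θ ω) ω)) P := by
    refine Integrable.of_bound (hΦc.measurable.comp ?_).aestronglyMeasurable M
      (ae_of_all _ fun ω => hM _)
    exact (measurable_uncurry_of_continuous_of_measurable
      hB.continuous hB.measurable).comp (hθm.prodMk measurable_id)
  have hbi : ∀ a : ℝ, Integrable (bad.indicator fun _ => a) P := fun a =>
    (integrable_const a).indicator hbadm
  have hbI : ∀ a : ℝ, ∫ ω, bad.indicator (fun _ => a) ω ∂P = P.real bad * a := fun a => by
    rw [integral_indicator_const _ hbadm, smul_eq_mul]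
  have hstep1 : semigroup B P W t f x ≤ ∫ ω, Φ (B (θ ω) ω) ∂P + P.real bad * (2 * M) := by
    rw [semigroup, ← hbI, ← integral_add hΦi (hbi _)]
    refine integral_mono ?_ (hΦi.add (hbi _)) fun ω => ?_
    · exact Integrable.of_bound
        (f.continuous.measurable.comp (measurable_process hB hW x ht)).aestronglyMeasurable M
        (ae_of_all _ fun ω => hM _)
    · by_cases hω : ω ∈ bad
      · have h5 := (abs_le.1 (hM (process B W x t ω))).2
        have h6 := (abs_le.1 (hM (scaleInv W (y + B (θ ω) ω)))).1
        simp only [hω, Set.indicator_of_mem, hΦ]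
        linarith
      · simp [hω, hΦ, (hgood ω hω).1]
  have hθi : Integrable (fun ω => (θ ω : ℝ)) P :=
    Integrable.of_bound hθm.coe_nnreal_real.aestronglyMeasurable (t / l)
      (ae_of_all _ fun ω => by rw [Real.norm_of_nonneg (θ ω).coe_nonneg]; exact hθle ω)
  have hstep2 : κ * ∫ ω, (θ ω : ℝ) ∂P ≤
      κ * (t / m) + |κ| * (t * (1 / l - 1 / r) + P.real bad * (t / l)) := by
    have h1 : |∫ ω, ((θ ω : ℝ) - t / m) ∂P| ≤ t * (1 / l - 1 / r) + P.real bad * (t / l) := by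
      calc _ ≤ ∫ ω, |(θ ω : ℝ) - t / m| ∂P := abs_integral_le_integral_abs
        _ ≤ ∫ ω, (t * (1 / l - 1 / r) + bad.indicator (fun _ => t / l) ω) ∂P := by
            refine integral_mono (hθi.sub (integrable_const _)).abs
              ((integrable_const _).add (hbi _)) fun ω => ?_
            have b1 : t / m ≤ t / l := by gcongr; exact hmlr.1
            have b2 : t / r ≤ t / m := by gcongr; exact hmlr.2
            have b3 : t * (1 / l - 1 / r) = t / l - t / r := by ring
            have b4 : (0 : ℝ) ≤ t / r := by positivity
            have b5 := hθle ω
            beta_reduce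
            rw [b3]
            by_cases hω : ω ∈ bad
            · rw [Set.indicator_of_mem hω, abs_le]
              have := (θ ω).coe_nonneg
              constructor <;> linarith
            · rw [Set.indicator_of_notMem hω, abs_le]
              have := (hgood ω hω).2
              constructor <;> linarith
        _ = _ := by
            rw [integral_add (integrable_const _) (hbi _), hbI]
            simp
    rw [integral_sub hθi (integrable_const _)] at h1
    simp only [integral_const, probReal_univ, smul_eq_mul, one_mul] at h1
    have h2 : κ * (∫ ω, (θ ω : ℝ) ∂P - t / m) ≤
        |κ| * (t * (1 / l - 1 / r) + P.real bad * (t / l)) := by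
      calc _ ≤ |κ * (∫ ω, (θ ω : ℝ) ∂P - t / m)| := le_abs_self _
        _ = |κ| * |∫ ω, (θ ω : ℝ) ∂P - t / m| := abs_mul _ _
        _ ≤ _ := by gcongr
    linarith
  rw [hΦ0, hcv] at hmain
  have hPb0 : 0 ≤ P.real bad := measureReal_nonneg
  have g1 : P.real bad * (2 * M) ≤ Q / (l ^ 2 * δ ^ 4) * t ^ 2 * (2 * M) := by gcongr
  have g2 : |κ| * (P.real bad * (t / l)) ≤ |κ| / l * (Q / (l ^ 2 * δ ^ 4)) * t ^ 2 := by
    calc _ ≤ |κ| * (Q / (l ^ 2 * δ ^ 4) * t ^ 2 * (1 / l)) := by gcongr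
      _ = _ := by ring
  calc semigroup B P W t f x - f x
      ≤ κ * (t / m) + |κ| * (t * (1 / l - 1 / r)) + K * (Q * (t / l) ^ 2) +
        Q / (l ^ 2 * δ ^ 4) * t ^ 2 * (2 * M) + |κ| / l * (Q / (l ^ 2 * δ ^ 4)) * t ^ 2 := by
        linarith
    _ = _ := by ring

/-- The maximum principle for the generator: if `f` lies below a parabola with leading
coefficient `κ` in the scale coordinate near `x`, then `m(x) · L f(x) ≤ κ`. -/
theorem generator_le_of_touching (hB : IsRegularBrownian B P) (hW : IsEnvironment W)
    {f g : C₀(ℝ, ℝ)} (hfg : IsGenerator B P W f g) (x p κ : ℝ)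
    (htouch : ∀ᶠ z in 𝓝 (scale W x),
      f (scaleInv W z) ≤ f x + p * (z - scale W x) + κ * (z - scale W x) ^ 2) :
    g x * speed W (scale W x) ≤ κ := by
  set y := scale W x with hy
  set m := speed W y with hm
  have hm0 : 0 < m := speed_pos y
  have key : ∀ ε, 0 < ε → ε < m → g x ≤ κ / m + |κ| * (1 / (m - ε) - 1 / (m + ε)) := by
    intro ε hε hεm
    have hnear : ∀ᶠ z in 𝓝 y, |speed W z - m| < ε := by
      have := (hW.continuous_speed.tendsto y).eventually (Metric.ball_mem_nhds m hε)
      simpa [Real.dist_eq] using this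
    obtain ⟨δ, hδ, hball⟩ := Metric.eventually_nhds_iff_ball.1 (hnear.and htouch)
    have hb2 : ∀ z, |z - y| ≤ δ / 2 → z ∈ Metric.ball y δ := fun z hz => by
      rw [Metric.mem_ball, Real.dist_eq]; linarith
    obtain ⟨C, hC⟩ := exists_semigroup_sub_le hB hW f x (p := p) (κ := κ) (half_pos hδ)
      (sub_pos.2 hεm) (r := m + ε)
      (fun z hz => by
        have := abs_lt.1 (hball z (hb2 z hz)).1
        constructor <;> linarith)
      (fun z hz => (hball z (hb2 z hz)).2)
    have hlim := hfg.tendsto_at x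
    have hlim2 : Tendsto (fun t : ℝ => κ / m + |κ| * (1 / (m - ε) - 1 / (m + ε)) + C * t)
        (𝓝[>] 0) (𝓝 (κ / m + |κ| * (1 / (m - ε) - 1 / (m + ε)) + C * 0)) := by
      refine Tendsto.mono_left ?_ nhdsWithin_le_nhds
      exact Continuous.tendsto (by fun_prop) 0
    rw [mul_zero, add_zero] at hlim2
    refine le_of_tendsto_of_tendsto hlim hlim2 ?_
    filter_upwards [Ioc_mem_nhdsGT (zero_lt_one' ℝ)] with t ht
    rw [div_le_iff₀' ht.1]
    exact hC t ht.1 ht.2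
  have hlim : Tendsto (fun ε : ℝ => κ / m + |κ| * (1 / (m - ε) - 1 / (m + ε))) (𝓝[>] 0)
      (𝓝 (κ / m + |κ| * (1 / (m - 0) - 1 / (m + 0)))) := by
    refine Tendsto.mono_left ?_ nhdsWithin_le_nhds
    refine ContinuousAt.tendsto (f := fun ε : ℝ => κ / m + |κ| * (1 / (m - ε) - 1 / (m + ε))) ?_
    have h1 : m - 0 ≠ 0 := by simpa using hm0.ne'
    have h2 : m + 0 ≠ 0 := by simpa using hm0.ne'
    fun_prop (disch := assumption)
  have := ge_of_tendsto hlim (by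
    filter_upwards [Ioo_mem_nhdsGT hm0] with ε hε using key ε hε.1 hε.2)
  rw [sub_zero, add_zero, sub_self, mul_zero, add_zero, le_div_iff₀ hm0] at this
  exact this

theorem IsGenerator.neg {f g : C₀(ℝ, ℝ)} (h : IsGenerator B P W f g) :
    IsGenerator B P W (-f) (-g) := by
  have h1 := (UniformContinuous.comp_tendstoUniformly uniformContinuous_neg h)
  refine (tendstoUniformly_congr (Eventually.of_forall fun t => ?_)).1 h1
  funext x
  simp only [Function.comp_apply, semigroup, ZeroAtInftyContinuousMap.neg_apply, integral_neg]
  ring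

theorem contDiff_of_mem_domain_of_isRegularBrownian (hB : IsRegularBrownian B P)
    (hW : IsEnvironment W) {f : C₀(ℝ, ℝ)} (hf : f ∈ domain B P W) :
    ContDiff ℝ 1 (f : ℝ → ℝ) := by
  obtain ⟨g, hg⟩ := hf
  have hF : ContDiff ℝ 1 fun z => f (scaleInv W z) := by
    refine contDiff_one_of_touching (k := fun z => g (scaleInv W z) * speed W z)
      (f.continuous.comp hW.continuous_scaleInv)
      ((g.continuous.comp hW.continuous_scaleInv).mul hW.continuous_speed)
      (fun y p κ ht => ?_) (fun y p κ ht => ?_)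
    · have := generator_le_of_touching hB hW hg (scaleInv W y) p κ
      rw [hW.scale_scaleInv] at this
      exact this ht
    · have := generator_le_of_touching hB hW hg.neg (scaleInv W y) (-p) (-κ)
      rw [hW.scale_scaleInv] at this
      have := this (by
        filter_upwards [ht] with z hz
        simp only [ZeroAtInftyContinuousMap.neg_apply]
        linarith)
      simp only [ZeroAtInftyContinuousMap.neg_apply] at this
      linarith
  have hcomp : (f : ℝ → ℝ) = (fun z => f (scaleInv W z)) ∘ scale W := by
    funext x; simp [hW.scaleInv_scale]
  rw [hcomp]
  exact hF.comp (contDiff_scale hW.continuous)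

/-- Replacing a Brownian motion by its regular version changes neither the semigroup nor the
domain. -/
theorem contDiff_of_mem_domain (hB : IsBrownianReal B P) (hW : IsEnvironment W) {f : C₀(ℝ, ℝ)}
    (hf : f ∈ domain B P W) : ContDiff ℝ 1 (f : ℝ → ℝ) := by
  obtain ⟨B', hB', hae⟩ := exists_isRegularBrownian hB
  have hsemi : semigroup B P W = semigroup B' P W := by
    funext t f x
    refine integral_congr_ae ?_
    filter_upwards [hae] with ω hω
    have : (fun s => scale W x + B s ω) = fun s => scale W x + B' s ω := by
      funext s; rw [hω s]
    simp only [process, this]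
  refine contDiff_of_mem_domain_of_isRegularBrownian hB' hW (f := f) ?_
  obtain ⟨g, hg⟩ := hf
  refine ⟨g, ?_⟩
  rwa [IsGenerator, ← hsemi]

end Brox

/-! ### The exponential functional of Brownian motion is infinite -/

/-- The functional `∫₀^∞ e^{w(s)} ds` of a path `w`. The path is read on finer and finer grids, so
that the functional is measurable for the product `σ`-algebra on all paths; see
`expFunctional_of_continuous` for its value at a continuous path. -/
noncomputable def expFunctional (w : ℝ≥0 → ℝ) : ENNReal :=
  ∫⁻ s in Set.Ioi (0 : ℝ), limsup (fun n : ℕ =>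
    ENNReal.ofReal (Real.exp (w ((⌊((n + 1 : ℕ) : ℝ) * s⌋₊ : ℝ≥0) / (n + 1 : ℕ))))) atTop

theorem measurable_expFunctional : Measurable expFunctional := by
  have hgrid : ∀ n : ℕ, Measurable fun z : (ℝ≥0 → ℝ) × ℝ =>
      z.1 ((⌊((n + 1 : ℕ) : ℝ) * z.2⌋₊ : ℝ≥0) / (n + 1 : ℕ)) := by
    intro n
    have h1 : Measurable fun z : (ℝ≥0 → ℝ) × ℕ => z.1 ((z.2 : ℝ≥0) / (n + 1 : ℕ)) :=
      measurable_from_prod_countable_left fun k => measurable_pi_apply ((k : ℝ≥0) / (n + 1 : ℕ))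
    exact h1.comp (measurable_fst.prodMk (Nat.measurable_floor.comp (measurable_snd.const_mul _)))
  exact (Measurable.limsup fun n =>
    (Real.measurable_exp.comp (hgrid n)).ennreal_ofReal).lintegral_prod_right'

theorem expFunctional_of_continuous {w : ℝ≥0 → ℝ} (hw : Continuous w) :
    expFunctional w = ∫⁻ s in Set.Ioi (0 : ℝ), ENNReal.ofReal (Real.exp (w s.toNNReal)) := by
  refine setLIntegral_congr_fun measurableSet_Ioi fun s hs => ?_
  have hs0 : (0 : ℝ) ≤ s := le_of_lt hs
  have hlim : Tendsto (fun n : ℕ => (⌊((n + 1 : ℕ) : ℝ) * s⌋₊ : ℝ≥0) / (n + 1 : ℕ)) atTop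
      (𝓝 s.toNNReal) := by
    have h1 := ((tendsto_nat_floor_mul_div_atTop (R := ℝ) hs0).comp
      tendsto_natCast_atTop_atTop).comp (tendsto_add_atTop_nat 1)
    rw [← NNReal.tendsto_coe, Real.coe_toNNReal _ hs0]
    refine h1.congr fun n => ?_
    simp [mul_comm]
  exact ((ENNReal.continuous_ofReal.comp (Real.continuous_exp.comp hw)).tendsto _
    |>.comp hlim).limsup_eq

/-- Finiteness of the exponential functional is a property of the path after time `t₀`. -/
theorem expFunctional_lt_top_iff_shift {w : ℝ≥0 → ℝ} (hw : Continuous w) (t₀ : ℝ≥0) :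
    expFunctional w < ⊤ ↔ expFunctional (fun t => w (t₀ + t) - w t₀) < ⊤ := by
  rw [expFunctional_of_continuous hw, expFunctional_of_continuous (by fun_prop)]
  set F : ℝ → ENNReal := fun s => ENNReal.ofReal (Real.exp (w s.toNNReal)) with hF
  have hsplit : ∫⁻ s in Set.Ioi (0 : ℝ), F s =
      (∫⁻ s in Set.Ioc (0 : ℝ) t₀, F s) + ∫⁻ s in Set.Ioi (t₀ : ℝ), F s := by
    rw [← Set.Ioc_union_Ioi_eq_Ioi t₀.coe_nonneg,
      lintegral_union measurableSet_Ioi (Set.Ioc_disjoint_Ioi le_rfl)]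
  have hfin : ∫⁻ s in Set.Ioc (0 : ℝ) t₀, F s < ⊤ := by
    have hc : Continuous fun s : ℝ => Real.exp (w s.toNNReal) :=
      Real.continuous_exp.comp (hw.comp continuous_real_toNNReal)
    have h1 : IntegrableOn (fun s : ℝ => Real.exp (w s.toNNReal)) (Set.Ioc 0 t₀) :=
      (hc.integrableOn_Icc).mono_set Set.Ioc_subset_Icc_self
    exact h1.lintegral_lt_top
  have hshift : ∫⁻ s in Set.Ioi (t₀ : ℝ), F s = ENNReal.ofReal (Real.exp (w t₀)) *
      ∫⁻ s in Set.Ioi (0 : ℝ), ENNReal.ofReal (Real.exp (w (t₀ + s.toNNReal) - w t₀)) := by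
    have h1 := (measurePreserving_add_left volume (t₀ : ℝ)).setLIntegral_comp_preimage_emb
      (measurableEmbedding_addLeft _) F (Set.Ioi (t₀ : ℝ))
    have h2 : (fun s : ℝ => (t₀ : ℝ) + s) ⁻¹' Set.Ioi (t₀ : ℝ) = Set.Ioi 0 := by
      ext s; simp
    rw [h2] at h1
    rw [← h1, ← lintegral_const_mul' _ _ ENNReal.ofReal_ne_top]
    refine setLIntegral_congr_fun measurableSet_Ioi fun s hs => ?_
    rw [← ENNReal.ofReal_mul (Real.exp_pos _).le, ← Real.exp_add]
    simp only [hF]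
    rw [Real.toNNReal_add t₀.coe_nonneg (le_of_lt hs), Real.toNNReal_coe]
    congr 2
    ring
  rw [hsplit, ENNReal.add_lt_top, hshift]
  simp only [hfin, true_and]
  rw [ENNReal.mul_lt_top_iff]
  have hpos : ENNReal.ofReal (Real.exp (w t₀)) ≠ 0 := by simp [Real.exp_pos]
  constructor
  · rintro (h | h | h)
    · exact h.2
    · exact absurd h hpos
    · rw [h]; exact ENNReal.zero_lt_top
  · exact fun h => Or.inl ⟨ENNReal.ofReal_lt_top, h⟩

section ZeroOne

variable {Ω : Type*} [MeasurableSpace Ω] {P : Measure Ω} {B : ℝ≥0 → Ω → ℝ}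

theorem IsRegularBrownian.neg (hB : IsRegularBrownian B P) : IsRegularBrownian (-B) P where
  toIsPreBrownianReal := hB.toIsPreBrownianReal.neg
  measurable t := (hB.measurable t).neg
  continuous ω := (hB.continuous ω).neg
  zero ω := by simp [hB.zero]

theorem IsRegularBrownian.measurable_path (hB : IsRegularBrownian B P) :
    Measurable fun ω t => B t ω :=
  measurable_pi_lambda _ hB.measurable

/-- A zero-one law: the event is independent of the path up to every time `n`. -/
theorem IsRegularBrownian.measure_expFunctional_lt_top (hB : IsRegularBrownian B P) :
    P {ω | expFunctional (B · ω) < ⊤} = 0 ∨ P {ω | expFunctional (B · ω) < ⊤} = 1 := by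
  have hP : IsProbabilityMeasure P := hB.isGaussianProcess.isProbabilityMeasure
  set A := {ω | expFunctional (B · ω) < ⊤} with hA
  have hAm : MeasurableSet A :=
    (measurable_expFunctional.comp hB.measurable_path) measurableSet_Iio
  have hind : ∀ n : ℕ, Indep (pastField B n) (MeasurableSpace.generateFrom {A}) P := by
    intro n
    have h1 : Indep (pastField B n)
        (MeasurableSpace.comap (fun ω t => B (n + t) ω - B n ω) MeasurableSpace.pi) P :=
      (IndepFun_iff_Indep _ _ _).1 (hB.indepFun_shift n).symm
    refine indep_of_indep_of_le_right h1 (MeasurableSpace.generateFrom_le ?_)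
    rintro _ rfl
    refine ⟨{w | expFunctional w < ⊤}, measurable_expFunctional measurableSet_Iio, ?_⟩
    ext ω
    exact (expFunctional_lt_top_iff_shift (hB.continuous ω) n).symm
  have hle : MeasurableSpace.generateFrom {A} ≤ ‹MeasurableSpace Ω› :=
    MeasurableSpace.generateFrom_le (by rintro _ rfl; exact hAm)
  have hsup := indep_iSup_of_monotone hind (fun n => pastField_le hB.measurable n) hle
    (fun i j hij => pastField_mono (by exact_mod_cast hij))
  have hA1 : MeasurableSet[⨆ n : ℕ, pastField B n] A := by
    have hpath : Measurable[⨆ n : ℕ, pastField B n] fun ω t => B t ω := by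
      refine @measurable_pi_lambda _ _ _ (⨆ n : ℕ, pastField B n) _ _ fun t => ?_
      obtain ⟨n, hn⟩ := exists_nat_ge t
      exact (measurable_pastField hn).mono (le_iSup (fun n : ℕ => pastField B n) n) le_rfl
    exact (measurable_expFunctional.comp hpath) measurableSet_Iio
  exact measure_eq_zero_or_one_of_indepSet_self
    (hsup.indepSet_of_measurableSet hA1 (MeasurableSpace.measurableSet_generateFrom rfl))

/-- The functionals of `w` and `-w` are not both finite, as the larger of `e^w` and `e^{-w}` is at
least `1` everywhere. -/
theorem not_expFunctional_neg_lt_top {w : ℝ≥0 → ℝ} (hw : Continuous w)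
    (h : expFunctional w < ⊤) : ¬ expFunctional (-w) < ⊤ := by
  intro h'
  rw [expFunctional_of_continuous hw] at h
  rw [expFunctional_of_continuous hw.neg] at h'
  have hm : Measurable fun s : ℝ => ENNReal.ofReal (Real.exp (w s.toNNReal)) :=
    (Real.continuous_exp.comp (hw.comp continuous_real_toNNReal)).measurable.ennreal_ofReal
  have hsum := ENNReal.add_lt_top.2 ⟨h, h'⟩
  rw [← lintegral_add_left hm] at hsum
  have h1 : ∫⁻ _ in Set.Ioi (0 : ℝ), (1 : ENNReal) ≤ ∫⁻ s in Set.Ioi (0 : ℝ),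
      (ENNReal.ofReal (Real.exp (w s.toNNReal)) +
        ENNReal.ofReal (Real.exp ((-w) s.toNNReal))) := by
    refine lintegral_mono fun s => ?_
    rw [← ENNReal.ofReal_add (Real.exp_pos _).le (Real.exp_pos _).le, ENNReal.one_le_ofReal]
    rcases le_total 0 (w s.toNNReal) with h0 | h0
    · have := Real.one_le_exp h0
      have := Real.exp_pos ((-w) s.toNNReal)
      linarith
    · have := Real.one_le_exp (x := (-w) s.toNNReal) (by simpa using h0)
      have := Real.exp_pos (w s.toNNReal)
      linarith
  have := h1.trans_lt hsum
  simp at this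

theorem ae_expFunctional_eq_top (hB : IsBrownianReal B P) :
    ∀ᵐ ω ∂P, ∫⁻ s in Set.Ioi (0 : ℝ), ENNReal.ofReal (Real.exp (B s.toNNReal ω)) = ⊤ := by
  have hP : IsProbabilityMeasure P := hB.isGaussianProcess.isProbabilityMeasure
  obtain ⟨B', hB', hae⟩ := exists_isRegularBrownian hB
  -- `B'` and `-B'` have the same law on path space
  have hlaw : P.map (fun ω t => B' t ω) = P.map (fun ω t => (-B') t ω) := by
    rw [map_eq_iff_forall_finset_map_restrict_eq hB'.measurable_path.aemeasurable
      hB'.neg.measurable_path.aemeasurable]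
    intro I
    exact (hB'.hasLaw I).map_eq.trans (hB'.neg.hasLaw I).map_eq.symm
  have hS : MeasurableSet {w | expFunctional w < ⊤} := measurable_expFunctional measurableSet_Iio
  have hsymm : P {ω | expFunctional (B' · ω) < ⊤} = P {ω | expFunctional ((-B') · ω) < ⊤} := by
    have := congrArg (fun ν => ν {w | expFunctional w < ⊤}) hlaw
    beta_reduce at this
    rwa [Measure.map_apply hB'.measurable_path hS, Measure.map_apply hB'.neg.measurable_path hS]
      at this
  have hdisj : Disjoint {ω | expFunctional (B' · ω) < ⊤} {ω | expFunctional ((-B') · ω) < ⊤} :=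
    Set.disjoint_left.2 fun ω h1 h2 => not_expFunctional_neg_lt_top (hB'.continuous ω) h1 h2
  have hzero : P {ω | expFunctional (B' · ω) < ⊤} = 0 := by
    rcases hB'.measure_expFunctional_lt_top with h | h
    · exact h
    · exfalso
      have h1 := measure_union (μ := P) hdisj (hB'.neg.measurable_path hS)
      rw [← hsymm, h] at h1
      have h2 : P _ ≤ 1 := prob_le_one (μ := P) (s := {ω | expFunctional (B' · ω) < ⊤} ∪
        {ω | expFunctional ((-B') · ω) < ⊤})
      rw [h1] at h2
      norm_num at h2
  have hae2 : ∀ᵐ ω ∂P, ¬ expFunctional (B' · ω) < ⊤ := by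
    rw [ae_iff]; simpa only [not_not] using hzero
  filter_upwards [hae, hae2] with ω h1 h2
  rw [expFunctional_of_continuous (hB'.continuous ω), not_lt_top_iff] at h2
  simpa only [h1] using h2

end ZeroOne

namespace Brox

/-! ### Two-sided Brownian trajectories are environments -/

theorem exists_le_integral_of_lintegral_eq_top {h : ℝ → ℝ} (hc : Continuous h) (h0 : ∀ x, 0 ≤ h x)
    (htop : ∫⁻ s in Set.Ioi (0 : ℝ), ENNReal.ofReal (h s) = ⊤) (C : ℝ) :
    ∃ x, C ≤ ∫ s in (0 : ℝ)..x, h s := by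
  by_contra! hlt
  have : IntegrableOn h (Set.Ioi 0) := by
    refine integrableOn_Ioi_of_intervalIntegral_norm_bounded (l := atTop) (b := fun x : ℝ => x) C 0
      (fun x => (hc.integrableOn_Icc).mono_set Set.Ioc_subset_Icc_self) tendsto_id
      (Eventually.of_forall fun x => ?_)
    simp_rw [Real.norm_of_nonneg (h0 _)]
    exact (hlt x).le
  exact this.lintegral_lt_top.ne htop

theorem isEnvironment_of_halves {W : ℝ → ℝ} (hr : Continuous fun x : ℝ≥0 => W x)
    (hl : Continuous fun x : ℝ≥0 => W (-x))
    (hr' : ∫⁻ s in Set.Ioi (0 : ℝ), ENNReal.ofReal (Real.exp (W s.toNNReal)) = ⊤)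
    (hl' : ∫⁻ s in Set.Ioi (0 : ℝ), ENNReal.ofReal (Real.exp (W (-s.toNNReal))) = ⊤) :
    IsEnvironment W := by
  have hW : Continuous W := by
    have : W = fun x : ℝ => if 0 ≤ x then W (x.toNNReal : ℝ) else W (-((-x).toNNReal : ℝ)) := by
      funext x
      split_ifs with hx
      · rw [Real.coe_toNNReal _ hx]
      · rw [Real.coe_toNNReal _ (by linarith), neg_neg]
    rw [this]
    refine Continuous.if_le (hr.comp continuous_real_toNNReal)
      (hl.comp (continuous_real_toNNReal.comp continuous_neg)) continuous_const continuous_id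
      fun x hx => ?_
    rw [← hx]; simp
  have hc : Continuous (scale W) := (contDiff_scale hW).continuous
  refine ⟨hW, fun C => mem_range_of_exists_le_of_exists_ge hc ?_ ?_⟩
  · have h1 : ∫⁻ s in Set.Ioi (0 : ℝ), ENNReal.ofReal (Real.exp (W (-s))) = ⊤ := by
      rw [← hl']
      refine setLIntegral_congr_fun measurableSet_Ioi fun s hs => ?_
      rw [Real.coe_toNNReal _ (le_of_lt hs)]
    obtain ⟨x, hx⟩ := exists_le_integral_of_lintegral_eq_top
      (Real.continuous_exp.comp (hW.comp continuous_neg)) (fun _ => (Real.exp_pos _).le) h1 (-C)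
    refine ⟨-x, ?_⟩
    have h2 := intervalIntegral.integral_comp_neg (a := 0) (b := x) fun y => Real.exp (W y)
    have h3 := intervalIntegral.integral_symm (μ := volume) (f := fun y => Real.exp (W y)) 0 (-x)
    rw [neg_zero] at h2
    simp only [Function.comp_apply] at hx
    unfold scale
    linarith
  · have h1 : ∫⁻ s in Set.Ioi (0 : ℝ), ENNReal.ofReal (Real.exp (W s)) = ⊤ := by
      rw [← hr']
      refine setLIntegral_congr_fun measurableSet_Ioi fun s hs => ?_
      rw [Real.coe_toNNReal _ (le_of_lt hs)]
    exact exists_le_integral_of_lintegral_eq_top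
      (Real.continuous_exp.comp hW) (fun _ => (Real.exp_pos _).le) h1 C

theorem IsTwoSidedBrownian.ae_isEnvironment {E : Type*} [MeasurableSpace E] {μ : Measure E}
    {W : ℝ → E → ℝ} (hW : IsTwoSidedBrownian W μ) :
    ∀ᵐ e ∂μ, IsEnvironment fun x => W x e := by
  filter_upwards [hW.right.cont, hW.left.cont, ae_expFunctional_eq_top hW.right,
    ae_expFunctional_eq_top hW.left] with e h1 h2 h3 h4
  exact isEnvironment_of_halves h1 h2 h3 h4

end Brox

theorem mainTheorem7 {Ω : Type*} [MeasurableSpace Ω] (P : Measure Ω) (B : ℝ≥0 → Ω → ℝ)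
    (hB : IsBrownianReal B P) :
    (∀ W : ℝ → ℝ, Brox.IsEnvironment W →
      ∀ f ∈ Brox.domain B P W, ContDiff ℝ 1 (f : ℝ → ℝ)) ∧
    (∀ (E : Type*) [MeasurableSpace E] (μ : Measure E) (W : ℝ → E → ℝ),
      Brox.IsTwoSidedBrownian W μ →
      ∀ᵐ e ∂μ, Brox.IsEnvironment (fun x => W x e) ∧
        ∀ f ∈ Brox.domain B P (fun x => W x e), ContDiff ℝ 1 (f : ℝ → ℝ)) := by
  refine ⟨fun W hW f hf => Brox.contDiff_of_mem_domain hB hW hf, fun E _ μ W hW => ?_⟩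
  filter_upwards [hW.ae_isEnvironment] with e he
  exact ⟨he, fun f hf => Brox.contDiff_of_mem_domain hB he hf⟩
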